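/- Let $r\ge 2$ and let $\Gamma_1,\dots,\Gamma_r$ be nontrivial groups with finite symmetric generating sets $S_1,\dots,S_r$, where the case $r=2=|\Gamma_1|=|\Gamma_2|$ is excluded. Let $\Gamma=\Gamma_1*\dots*\Gamma_r$ be the free product with identity $e$, let $\mathcal X$ be its Cayley graph with respect to $\bigcup_i S_i$, and let $l(x)$ be the graph distance from $e$ to $x$ in $\mathcal X$. A ray is an infinite path in $\mathcal X$ that starts at $e$ and has no repeated vertices. Two rays are equivalent if some third ray shares infinitely many vertices with each of them, and $\Omega$ is the set of equivalence classes (ends). Let $\Omega_\infty\subseteq\Omega$ be the set of ends described by infinite words $x_1x_2x_3\dots$ whose letters are non-trivial elements of the factors, consecutive letters lying in different factors; that is, the ends having a representative that passes through $x_1\cdots x_n$ for every $n\ge 0$. Fix $\alpha\in(0,1)$. For ends $\omega_1\ne\omega_2$ let $c(\omega_1,\omega_2)$ be the maximal $m\in\mathbb N_0$ such that $\omega_1,\omega_2$ end up in the same connected component of $\mathcal X\setminus\{x: l(x)\le m-1\}$. Equip $\Omega$ with the metric $d_\Omega(\omega_1,\omega_2)=\alpha^{c(\omega_1,\omega_2)}$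 for $\omega_1\neq\omega_2$ and $d_\Omega(\omega,\omega)=0$, and write $B(\omega,\varepsilon)=\{\omega' : d_\Omega(\omega,\omega')\le\varepsilon\}$. A cover of $\Omega'\subseteq\Omega$ is a finite or countable family of balls $B(\omega,\varepsilon_\omega)$ with $\omega\in\Omega'$ and $\varepsilon_\omega>0$ whose union contains $\Omega'$. Let $N_\varepsilon(\Omega')$ be the minimal number of balls in a cover of $\Omega'$ all of whose radii are at most $\varepsilon$. The box-counting dimension is $$\mathrm{BD}(\Omega')=\lim_{\varepsilon\downarrow0}\frac{\log N_\varepsilon(\Omega')}{-\log\varepsilon},$$ if the limit exists, and the Hausdorff dimension is $$\mathrm{HD}(\Omega')=\inf\{\delta\ge0:\mathcal H_\delta(\Omega')=0\},\qquad \mathcal H_\delta(\Omega')=\lim_{\varepsilon\downarrow0}\inf\Bigl\{\sum_i\varepsilon_i^\delta\Bigr\},$$ the inner infimum being over all covers of $\Omega'$ by balls of radii $\varepsilon_i<\varepsilon$. For $i\in\{1,\dots,r\}$ let $\mathcal S_i^+(z)=\sum_{m\ge1}|\{x\in\Gamma_i: l(x)=m\}|\,z^m$. Then there is a smallest real number $z^*_{\mathcal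 S}>0$ at which all the series $\mathcal S_i^+$ converge and $$\sum_{i=1}^r\frac{\mathcal S_i^+(z^*_{\mathcal S})}{1+\mathcal S_i^+(z^*_{\mathcal S})}=1,$$ the box-counting dimensions of $\Omega$ and $\Omega_\infty$ exist, and $$\mathrm{BD}(\Omega)=\mathrm{BD}(\Omega_\infty)=\mathrm{HD}(\Omega)=\mathrm{HD}(\Omega_\infty)=\frac{\log z^*_{\mathcal S}}{\log\alpha}.$$ -/

import Mathlib

open Filter Topology
open scoped ENNReal NNReal

noncomputable section

/-! ### Ends of a rooted graph -/

section Ends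

variable {V : Type*}

/-- A ray from the root `o`: a semi-infinite path `[o = x₀, x₁, x₂, …]` without repetitions. -/
structure RootedRay (X : SimpleGraph V) (o : V) where
  /-- the vertices of the ray -/
  vertex : ℕ → V
  vertex_zero : vertex 0 = o
  adj_succ : ∀ n, X.Adj (vertex n) (vertex (n + 1))
  injective : Function.Injective vertex

/-- Two rays are equivalent if some third ray shares infinitely many vertices with each of them. -/
def RayEquiv {X : SimpleGraph V} {o : V} (r₁ r₂ : RootedRay X o) : Prop :=
  ∃ r₃ : RootedRay X o,
    (Set.range r₃.vertex ∩ Set.range r₁.vertex).Infinite ∧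
    (Set.range r₃.vertex ∩ Set.range r₂.vertex).Infinite

/-- The space of ends: equivalence classes of rays. -/
def EndSpace (X : SimpleGraph V) (o : V) : Type _ :=
  Quot (RayEquiv (X := X) (o := o))

/-- The end represented by a ray. -/
def RootedRay.toEnd {X : SimpleGraph V} {o : V} (r : RootedRay X o) : EndSpace X o :=
  Quot.mk RayEquiv r

/-- An end is contained in a set of vertices if each of its representatives has all but finitely
many of its vertices in that set. -/
def EndSpace.ContainedIn {X : SimpleGraph V} {o : V} (ω : EndSpace X o) (A : Set V) : Prop :=
  ∀ r : RootedRay X o, r.toEnd = ω → ∀ᶠ n in atTop, r.vertex n ∈ A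

/-- The vertices at graph distance less than `m` from the root, i.e. the ball `B_{m-1}`
(so that `m = 0` gives the empty set). -/
def ballBelow (X : SimpleGraph V) (o : V) (m : ℕ) : Set V :=
  {x | X.dist o x < m}

/-- Both ends end up in the same connected component of `X ∖ B_{m-1}`. -/
def SameComponent {X : SimpleGraph V} {o : V} (m : ℕ) (ω₁ ω₂ : EndSpace X o) : Prop :=
  ∃ C : X.ComponentCompl (ballBelow X o m),
    ω₁.ContainedIn (C : Set V) ∧ ω₂.ContainedIn (C : Set V)

/-- `c(ω₁, ω₂)`: the maximal `m` such that both ends end up in the same component of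
`X ∖ B_{m-1}`. For distinct ends of a connected locally finite graph this is a natural number;
for `ω₁ = ω₂` every `m` qualifies and the value is `⊤`. -/
def confluence {X : SimpleGraph V} {o : V} (ω₁ ω₂ : EndSpace X o) : ℕ∞ :=
  ⨆ (m : ℕ) (_ : SameComponent m ω₁ ω₂), (m : ℕ∞)

open Classical in
/-- The metric `α ^ c(ω₁, ω₂)` on the space of ends, where `α ^ ⊤ = 0`, i.e. the distance of an
end to itself is `0`. -/
def endDist {X : SimpleGraph V} {o : V} (α : ℝ) (ω₁ ω₂ : EndSpace X o) : ℝ :=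
  if confluence ω₁ ω₂ = ⊤ then 0 else α ^ (confluence ω₁ ω₂).toNat

end Ends

/-! ### Box-counting and Hausdorff dimension with respect to a distance function -/

section Dimension

variable {E : Type*}

/-- A family of balls, recorded as pairs (centre, radius), is a cover of `A` if it is finite or
countable, the centres are in `A`, the radii are positive and the closed balls
`{ω' | d ω ω' ≤ ε}` cover `A`. -/
def IsBallCover (d : E → E → ℝ) (A : Set E) (C : Set (E × ℝ)) : Prop :=
  C.Countable ∧ (∀ p ∈ C, p.1 ∈ A ∧ 0 < p.2) ∧ ∀ ω ∈ A, ∃ p ∈ C, d p.1 ω ≤ p.2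

/-- `N_ε(A)`: the minimal number of balls with radii at most `ε` in a cover of `A`. -/
def coverNumber (d : E → E → ℝ) (A : Set E) (ε : ℝ) : ℕ∞ :=
  ⨅ (C : Set (E × ℝ)) (_ : IsBallCover d A C ∧ ∀ p ∈ C, p.2 ≤ ε), C.encard

/-- `log N_ε(A) / (- log ε)`. -/
def boxRatio (d : E → E → ℝ) (A : Set E) (ε : ℝ) : EReal :=
  ENNReal.log (coverNumber d A ε : ℝ≥0∞) / ((-Real.log ε : ℝ) : EReal)

/-- The lower box-counting dimension. -/
def lowerBoxDim (d : E → E → ℝ) (A : Set E) : EReal :=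
  liminf (boxRatio d A) (𝓝[>] (0 : ℝ))

/-- The upper box-counting dimension. -/
def upperBoxDim (d : E → E → ℝ) (A : Set E) : EReal :=
  limsup (boxRatio d A) (𝓝[>] (0 : ℝ))

/-- The box-counting dimension of `A` exists and equals `s`. -/
def HasBoxDim (d : E → E → ℝ) (A : Set E) (s : EReal) : Prop :=
  lowerBoxDim d A = s ∧ upperBoxDim d A = s

/-- The infimum of `∑ εᵢ ^ δ` over all covers of `A` by balls of radii `εᵢ < ε`. -/
def hausdorffContent (d : E → E → ℝ) (A : Set E) (δ ε : ℝ) : ℝ≥0∞ :=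
  ⨅ (C : Set (E × ℝ)) (_ : IsBallCover d A C ∧ ∀ p ∈ C, p.2 < ε),
    ∑' p : C, ENNReal.ofReal ((p : E × ℝ).2 ^ δ)

/-- The `δ`-dimensional Hausdorff measure: the limit of the above as `ε ↓ 0`, which is the
supremum over `ε > 0` because the infimum is monotone in `ε`. -/
def hausdorffMeas (d : E → E → ℝ) (A : Set E) (δ : ℝ) : ℝ≥0∞ :=
  ⨆ (ε : ℝ) (_ : 0 < ε), hausdorffContent d A δ ε

/-- The Hausdorff dimension `inf {δ ≥ 0 | H_δ(A) = 0}`. -/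
def hausdorffDim (d : E → E → ℝ) (A : Set E) : EReal :=
  ⨅ (δ : ℝ) (_ : 0 ≤ δ ∧ hausdorffMeas d A δ = 0), (δ : EReal)

end Dimension

/-! ### Free products of groups -/

section FreeProduct

variable {ι : Type*} {G : ι → Type*} [∀ i, Group (G i)]

/-- The Cayley graph of the free product of the `G i` with respect to the union of the generating
sets `S i` of the factors. -/
def freeProductGraph (S : ∀ i, Set (G i)) : SimpleGraph (Monoid.CoprodI G) :=
  SimpleGraph.mulCayley (⋃ i, (Monoid.CoprodI.of : G i →* Monoid.CoprodI G) '' S i)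

/-- The length `l(x)`: the graph distance of `x` to the identity. -/
def freeProductLength (S : ∀ i, Set (G i)) (x : Monoid.CoprodI G) : ℕ :=
  (freeProductGraph S).dist 1 x

/-- The end boundary `Ω` of the free product. -/
abbrev FreeProductEnds (S : ∀ i, Set (G i)) : Type _ :=
  EndSpace (freeProductGraph S) 1

/-- An infinite word `x₁x₂x₃…`: nontrivial letters, consecutive ones from different factors. -/
def IsInfiniteWord (x : ℕ → Σ i, G i) : Prop :=
  ∀ n, (x n).2 ≠ 1 ∧ (x n).1 ≠ (x (n + 1)).1

/-- The prefix of length `n` of an infinite word, as an element of the free product. -/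
def wordPrefix (x : ℕ → Σ i, G i) (n : ℕ) : Monoid.CoprodI G :=
  ((List.range n).map fun k => Monoid.CoprodI.of (x k).2).prod

/-- The set `Ω_∞` of ends described by infinite words: ends that have a representative ray passing
through all prefixes of some infinite word. -/
def infiniteWordEnds (S : ∀ i, Set (G i)) : Set (FreeProductEnds S) :=
  {ω | ∃ x : ℕ → Σ i, G i, IsInfiniteWord x ∧
    ∃ r : RootedRay (freeProductGraph S) 1,
      r.toEnd = ω ∧ ∀ n, wordPrefix x n ∈ Set.range r.vertex}

/-- `S_i(m)`: the number of elements of the `i`-th factor of length `m`. -/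
def sphereCount (S : ∀ i, Set (G i)) (i : ι) (m : ℕ) : ℕ :=
  {x : G i | freeProductLength S (Monoid.CoprodI.of x) = m}.ncard

/-- The terms `S_i(m) z ^ m`, `m ≥ 1`, of the sphere-counting series of the `i`-th factor. -/
def sphereTerm (S : ∀ i, Set (G i)) (i : ι) (z : ℝ) (m : ℕ) : ℝ :=
  (sphereCount S i (m + 1) : ℝ) * z ^ (m + 1)

/-- `S_i⁺(z) = ∑_{m ≥ 1} S_i(m) z ^ m`. -/
def sphereSeries (S : ∀ i, Set (G i)) (i : ι) (z : ℝ) : ℝ :=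
  ∑' m : ℕ, sphereTerm S i z m

/-- The positive reals at which all series `S_i⁺` converge and `∑ S_i⁺ / (1 + S_i⁺) = 1`. -/
def sphereRoots [Fintype ι] (S : ∀ i, Set (G i)) : Set ℝ :=
  {z | 0 < z ∧ (∀ i, Summable (sphereTerm S i z)) ∧
    ∑ i, sphereSeries S i z / (1 + sphereSeries S i z) = 1}

end FreeProduct

end

/-! ### Criteria for bounding dimensions -/

section DimensionCriteria

variable {E : Type*} {d : E → E → ℝ} {A : Set E}

/-! Put `z = α ^ δ`, so that a ball of radius `α ^ m` costs `z ^ m` in a δ-dimensional sum, and let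
`E i` be the value of `S_i⁺` at `z`. Lengths add along reduced words, so splitting off first letters
shows that the words of the free product have generating function `1 / (1 - P)` with `P = ∑ E i / (1
+ E i)`, as long as `P < 1`. The critical exponent is therefore the one at which `P = 1`.

Upper bounds (`P < 1`): the sphere of radius `m` has at most `K * z ^ (-m)` elements
(`exists_encard_sphere_le`). Every component outside a ball that contains an end has a vertex on the
bounding sphere, so that many balls of radius `α ^ m` cover all ends (`exists_isBallCover_endDist`).

Lower bounds (`P > 1`): a truncation of the series to letters of length at most `N` still has `P >
1`. A ball of radius about `α ^ m` fixes a prefix of length more than `m - N` of all truncated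
infinite words whose ends it contains, because the Cayley graph can leave the words starting with
`w` only at `w` (`prefix_of_mem_componentCompl`). A cover thus yields a family of prefixes met by
every such word, and a mass argument bounds its total weight below by `1`
(`one_le_tsum_pow_listLength`). Only ends of infinite words are used, so one argument serves both
`Ω` and `Ω_∞`.

The root exists because submultiplicative sphere counts keep the series from converging at their
radius of convergence, so `P` cannot jump past `1` (`exists_root_ratioSum`). It is less than `1`
because `P` exceeds `1` at `z = 1` outside the excluded case. -/

theorem coverNumber_le_encard {C : Set (E × ℝ)} {ε : ℝ} (hC : IsBallCover d A C)
    (hε : ∀ p ∈ C, p.2 ≤ ε) : coverNumber d A ε ≤ C.encard :=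
  iInf₂_le C ⟨hC, hε⟩

theorem eventually_mem_Ioo_nhdsGT_zero : ∀ᶠ ε : ℝ in 𝓝[>] 0, ε ∈ Set.Ioo (0 : ℝ) 1 :=
  Ioo_mem_nhdsGT one_pos

/-- Multiplicative constants in `N_ε` become the additive `c` and vanish in the limit. -/
theorem tendsto_const_add_div_neg_log (c δ : ℝ) :
    Tendsto (fun ε : ℝ => (((c + δ * (-Real.log ε)) / (-Real.log ε) : ℝ) : EReal))
      (𝓝[>] 0) (𝓝 (δ : EReal)) := by
  have h1 : Tendsto (fun ε : ℝ => -Real.log ε) (𝓝[>] 0) atTop :=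
    tendsto_neg_atBot_atTop.comp Real.tendsto_log_nhdsGT_zero
  have h2 : Tendsto (fun ε : ℝ => c / (-Real.log ε) + δ) (𝓝[>] 0) (𝓝 δ) := by
    simpa using (h1.const_div_atTop c).add_const δ
  refine (continuous_coe_real_ereal.tendsto δ).comp (h2.congr' ?_)
  filter_upwards [eventually_mem_Ioo_nhdsGT_zero] with ε hε
  have : -Real.log ε ≠ 0 := (neg_pos.2 (Real.log_neg hε.1 hε.2)).ne'
  rw [add_div, mul_div_cancel_right₀ _ this]

theorem upperBoxDim_le_of_cover {K δ : ℝ} (hK : 0 < K)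
    (h : ∀ ε : ℝ, 0 < ε → ε < 1 → ∃ C : Set (E × ℝ), IsBallCover d A C ∧ (∀ p ∈ C, p.2 ≤ ε) ∧
      (C.encard : ℝ≥0∞) ≤ ENNReal.ofReal (K * ε ^ (-δ))) :
    upperBoxDim d A ≤ δ := by
  refine (limsup_le_limsup ?_ ?_ ?_).trans
    (tendsto_const_add_div_neg_log (Real.log K) δ).limsup_eq.le
  rotate_left
  · isBoundedDefault
  · isBoundedDefault
  filter_upwards [eventually_mem_Ioo_nhdsGT_zero] with ε hε
  obtain ⟨C, hC, hCε, hcard⟩ := h ε hε.1 hε.2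
  have hlog : 0 < -Real.log ε := neg_pos.2 (Real.log_neg hε.1 hε.2)
  have hle : ENNReal.log (coverNumber d A ε : ℝ≥0∞)
      ≤ ((Real.log K + δ * (-Real.log ε) : ℝ) : EReal) := by
    calc ENNReal.log (coverNumber d A ε : ℝ≥0∞)
        ≤ ENNReal.log (ENNReal.ofReal (K * ε ^ (-δ))) :=
          ENNReal.log_monotone
            ((ENat.toENNReal_mono (coverNumber_le_encard hC hCε)).trans hcard)
      _ = _ := by
          have : 0 < ε ^ (-δ) := Real.rpow_pos_of_pos hε.1 _
          rw [ENNReal.log_ofReal_of_pos (by positivity),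
            Real.log_mul hK.ne' this.ne', Real.log_rpow hε.1]
          congr 1
          ring
  rw [boxRatio, EReal.coe_div]
  exact EReal.div_le_div_right_of_nonneg (by exact_mod_cast hlog.le) hle

/-- A cover at scale `η` costs at most `K * η ^ (-δ) * η ^ δ'`, which tends to `0` with `η`; all
covers with `η < ε` compete in the content at scale `ε`. -/
theorem hausdorffMeas_eq_zero_of_cover {K δ δ' : ℝ} (hδ : δ < δ')
    (h : ∀ ε : ℝ, 0 < ε → ε < 1 → ∃ C : Set (E × ℝ), IsBallCover d A C ∧ (∀ p ∈ C, p.2 ≤ ε) ∧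
      (C.encard : ℝ≥0∞) ≤ ENNReal.ofReal (K * ε ^ (-δ))) (hδ' : 0 ≤ δ') :
    hausdorffMeas d A δ' = 0 := by
  simp only [hausdorffMeas, ENNReal.iSup_eq_zero]
  intro ε hε
  have hle : ∀ η : ℝ, 0 < η → η < min ε 1 →
      hausdorffContent d A δ' ε ≤ ENNReal.ofReal (K * η ^ (δ' - δ)) := by
    intro η hη0 hη
    obtain ⟨C, hC, hCη, hcard⟩ := h η hη0 (hη.trans_le (min_le_right _ _))
    refine (iInf₂_le C ⟨hC, fun p hp => (hCη p hp).trans_lt (hη.trans_le (min_le_left _ _))⟩).trans ?_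
    calc ∑' p : C, ENNReal.ofReal ((p : E × ℝ).2 ^ δ')
        ≤ ∑' _ : C, ENNReal.ofReal (η ^ δ') := by
          refine ENNReal.tsum_le_tsum fun p => ENNReal.ofReal_le_ofReal ?_
          exact Real.rpow_le_rpow (hC.2.1 p p.2).2.le (hCη p p.2) hδ'
      _ = (C.encard : ℝ≥0∞) * ENNReal.ofReal (η ^ δ') := by
          rw [ENNReal.tsum_const]; rfl
      _ ≤ ENNReal.ofReal (K * η ^ (-δ)) * ENNReal.ofReal (η ^ δ') := by gcongr
      _ = ENNReal.ofReal (K * η ^ (δ' - δ)) := by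
          rw [← ENNReal.ofReal_mul' (by positivity), mul_assoc, ← Real.rpow_add hη0]
          congr 3
          ring
  have ht : Tendsto (fun η : ℝ => ENNReal.ofReal (K * η ^ (δ' - δ))) (𝓝[>] 0) (𝓝 0) := by
    have h0 : Tendsto (fun η : ℝ => η ^ (δ' - δ)) (𝓝[>] 0) (𝓝 0) := by
      have := (Real.continuousAt_rpow_const 0 (δ' - δ) (Or.inr (by linarith))).tendsto
      rw [Real.zero_rpow (by linarith)] at this
      exact this.mono_left nhdsWithin_le_nhds
    simpa using ENNReal.tendsto_ofReal (h0.const_mul K)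
  refine le_antisymm (ge_of_tendsto ht ?_) bot_le
  filter_upwards [Ioo_mem_nhdsGT (show (0 : ℝ) < min ε 1 by positivity)] with η hη
  exact hle η hη.1 hη.2

theorem hausdorffDim_le_of_cover {K δ : ℝ} (hδ0 : 0 ≤ δ)
    (h : ∀ ε : ℝ, 0 < ε → ε < 1 → ∃ C : Set (E × ℝ), IsBallCover d A C ∧ (∀ p ∈ C, p.2 ≤ ε) ∧
      (C.encard : ℝ≥0∞) ≤ ENNReal.ofReal (K * ε ^ (-δ))) :
    hausdorffDim d A ≤ δ := by
  refine EReal.le_of_forall_lt_iff_le.1 fun z hz => ?_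
  have hz' : δ < z := by exact_mod_cast hz
  exact iInf₂_le z ⟨by linarith, hausdorffMeas_eq_zero_of_cover hz' h (by linarith)⟩

/-- With radii at most `ε`, each term of the sum is at most `ε ^ δ`, so at least `c * ε ^ (-δ)`
balls are needed. -/
theorem le_lowerBoxDim_of_le_sum {c δ : ℝ} (hc : 0 < c) (hδ0 : 0 ≤ δ)
    (h : ∀ C : Set (E × ℝ), IsBallCover d A C → (∀ p ∈ C, p.2 < 1) →
      ENNReal.ofReal c ≤ ∑' p : C, ENNReal.ofReal ((p : E × ℝ).2 ^ δ)) :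
    (δ : EReal) ≤ lowerBoxDim d A := by
  refine (tendsto_const_add_div_neg_log (Real.log c) δ).liminf_eq.ge.trans
    (liminf_le_liminf ?_ ?_ ?_)
  rotate_left
  · isBoundedDefault
  · isBoundedDefault
  filter_upwards [eventually_mem_Ioo_nhdsGT_zero] with ε hε
  have hlog : 0 < -Real.log ε := neg_pos.2 (Real.log_neg hε.1 hε.2)
  have hpos : 0 < ε ^ (-δ) := Real.rpow_pos_of_pos hε.1 _
  have hcov : ENNReal.ofReal (c * ε ^ (-δ)) ≤ (coverNumber d A ε : ℝ≥0∞) := by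
    have key : ∀ C : Set (E × ℝ), IsBallCover d A C → (∀ p ∈ C, p.2 ≤ ε) →
        ENNReal.ofReal (c * ε ^ (-δ)) ≤ (C.encard : ℝ≥0∞) := by
      intro C hC hCε
      have h1 := h C hC fun p hp => (hCε p hp).trans_lt hε.2
      calc ENNReal.ofReal (c * ε ^ (-δ))
          = ENNReal.ofReal c * ENNReal.ofReal (ε ^ (-δ)) := ENNReal.ofReal_mul hc.le
        _ ≤ (∑' _ : C, ENNReal.ofReal (ε ^ δ)) * ENNReal.ofReal (ε ^ (-δ)) := by
            gcongr
            refine h1.trans (ENNReal.tsum_le_tsum fun p => ENNReal.ofReal_le_ofReal ?_)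
            exact Real.rpow_le_rpow (hC.2.1 p p.2).2.le (hCε p p.2) hδ0
        _ = (C.encard : ℝ≥0∞) * (ENNReal.ofReal (ε ^ δ) * ENNReal.ofReal (ε ^ (-δ))) := by
            rw [ENNReal.tsum_const, mul_assoc]; rfl
        _ = (C.encard : ℝ≥0∞) := by
            rw [← ENNReal.ofReal_mul' hpos.le, ← Real.rpow_add hε.1]
            simp
    -- An infimum in `ℕ∞` over a nonempty family is attained; over the empty family it is `⊤`.
    rw [coverNumber, iInf_subtype']
    by_cases hne : Nonempty {C : Set (E × ℝ) // IsBallCover d A C ∧ ∀ p ∈ C, p.2 ≤ ε}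
    · obtain ⟨C, hC⟩ := ciInf_mem fun C : {C : Set (E × ℝ) //
          IsBallCover d A C ∧ ∀ p ∈ C, p.2 ≤ ε} => C.1.encard
      rw [← hC]
      exact key C.1 C.2.1 C.2.2
    · rw [not_nonempty_iff] at hne
      simp [iInf_of_empty]
  have hle : ((Real.log c + δ * (-Real.log ε) : ℝ) : EReal)
      ≤ ENNReal.log (coverNumber d A ε : ℝ≥0∞) := by
    refine le_trans (le_of_eq ?_) (ENNReal.log_monotone hcov)
    rw [ENNReal.log_ofReal_of_pos (by positivity),
      Real.log_mul hc.ne' hpos.ne', Real.log_rpow hε.1]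
    congr 1
    ring
  rw [boxRatio, EReal.coe_div]
  exact EReal.div_le_div_right_of_nonneg (by exact_mod_cast hlog.le) hle

/-- Radii are below `1`, so lowering the exponent only increases the sums: the measure is at least
`c` for every exponent below `δ`. -/
theorem le_hausdorffDim_of_le_sum {c δ : ℝ} (hc : 0 < c)
    (h : ∀ C : Set (E × ℝ), IsBallCover d A C → (∀ p ∈ C, p.2 < 1) →
      ENNReal.ofReal c ≤ ∑' p : C, ENNReal.ofReal ((p : E × ℝ).2 ^ δ)) :
    (δ : EReal) ≤ hausdorffDim d A := by
  refine le_iInf₂ fun δ' hδ' => ?_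
  by_contra hlt
  have hlt' : δ' < δ := by exact_mod_cast not_le.1 hlt
  have hcontent : ENNReal.ofReal c ≤ hausdorffContent d A δ' 1 := by
    refine le_iInf₂ fun C hC => (h C hC.1 hC.2).trans (ENNReal.tsum_le_tsum fun p => ?_)
    exact ENNReal.ofReal_le_ofReal (Real.rpow_le_rpow_of_exponent_ge (hC.1.2.1 p p.2).2
      (hC.2 p p.2).le hlt'.le)
  have : ENNReal.ofReal c ≤ hausdorffMeas d A δ' :=
    hcontent.trans (le_iSup₂ (f := fun ε (_ : 0 < ε) => hausdorffContent d A δ' ε) 1 one_pos)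
  rw [hδ'.2] at this
  exact absurd this (by simpa using hc)

theorem lowerBoxDim_le_upperBoxDim : lowerBoxDim d A ≤ upperBoxDim d A :=
  liminf_le_limsup (by isBoundedDefault) (by isBoundedDefault)

end DimensionCriteria

/-! ### The equation `∑ E i / (1 + E i) = 1` for power series `E i` -/

section RatioSum

theorem summable_pow_of_le {c : ℕ → ℝ} (hc : ∀ m, 0 ≤ c m) {y z : ℝ} (hy : 0 ≤ y) (hyz : y ≤ z)
    (hs : Summable fun m => c m * z ^ (m + 1)) : Summable fun m => c m * y ^ (m + 1) :=
  hs.of_nonneg_of_le (fun m => mul_nonneg (hc m) (by positivity))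
    fun m => mul_le_mul_of_nonneg_left (by gcongr) (hc m)

variable {ι : Type*} [Fintype ι]

/-- The sum of `E i / (1 + E i)`, where `E i = ∑ m, a i m * z ^ (m + 1)`. -/
noncomputable def ratioSum (a : ι → ℕ → ℝ) (z : ℝ) : ℝ :=
  ∑ i, (∑' m, a i m * z ^ (m + 1)) / (1 + ∑' m, a i m * z ^ (m + 1))

/-- The analogue of `ratioSum` for the truncations of the power series to their first `n` terms. -/
noncomputable def truncRatioSum (a : ι → ℕ → ℝ) (n : ℕ) (z : ℝ) : ℝ :=
  ∑ i, (∑ m ∈ Finset.range n, a i m * z ^ (m + 1)) /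
    (1 + ∑ m ∈ Finset.range n, a i m * z ^ (m + 1))

theorem div_one_add_le_div_one_add {x y : ℝ} (hx : 0 ≤ x) (h : x ≤ y) :
    x / (1 + x) ≤ y / (1 + y) := by
  rw [div_le_div_iff₀ (by linarith) (by linarith)]
  nlinarith

theorem div_one_add_lt_div_one_add {x y : ℝ} (hx : 0 ≤ x) (h : x < y) :
    x / (1 + x) < y / (1 + y) := by
  rw [div_lt_div_iff₀ (by linarith) (by linarith)]
  nlinarith

theorem div_one_add_nonneg {x : ℝ} (hx : 0 ≤ x) : 0 ≤ x / (1 + x) := by positivity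

variable {a : ι → ℕ → ℝ}

theorem truncRatioSum_le_ratioSum (ha : ∀ i m, 0 ≤ a i m) {z : ℝ} (hz : 0 ≤ z)
    (hs : ∀ i, Summable fun m => a i m * z ^ (m + 1)) (n : ℕ) :
    truncRatioSum a n z ≤ ratioSum a z :=
  Finset.sum_le_sum fun i _ => div_one_add_le_div_one_add
    (Finset.sum_nonneg fun m _ => mul_nonneg (ha i m) (by positivity))
    ((hs i).sum_le_tsum _ fun m _ => mul_nonneg (ha i m) (by positivity))

theorem continuousOn_truncRatioSum (ha : ∀ i m, 0 ≤ a i m) (n : ℕ) :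
    ContinuousOn (truncRatioSum a n) (Set.Ici 0) := by
  unfold truncRatioSum
  refine continuousOn_finsetSum _ fun i _ => ContinuousOn.div (by fun_prop) (by fun_prop) ?_
  intro z hz
  have : 0 ≤ ∑ m ∈ Finset.range n, a i m * z ^ (m + 1) :=
    Finset.sum_nonneg fun m _ => mul_nonneg (ha i m) (pow_nonneg hz _)
  positivity

theorem tendsto_truncRatioSum (ha : ∀ i m, 0 ≤ a i m) {z : ℝ} (hz : 0 ≤ z)
    (hs : ∀ i, Summable fun m => a i m * z ^ (m + 1)) :
    Tendsto (fun n => truncRatioSum a n z) atTop (𝓝 (ratioSum a z)) := by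
  refine tendsto_finsetSum _ fun i _ => ?_
  have h := (hs i).hasSum.tendsto_sum_nat
  have h0 : 0 ≤ ∑' m, a i m * z ^ (m + 1) :=
    tsum_nonneg fun m => mul_nonneg (ha i m) (by positivity)
  exact h.div (tendsto_const_nhds.add h) (by positivity)

theorem ratioSum_lt_ratioSum [Nonempty ι] (ha : ∀ i m, 0 ≤ a i m) (hpos : ∀ i, ∃ m, 0 < a i m)
    {y z : ℝ} (hy : 0 ≤ y) (hyz : y < z)
    (hs : ∀ i, Summable fun m => a i m * z ^ (m + 1)) : ratioSum a y < ratioSum a z := by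
  refine Finset.sum_lt_sum_of_nonempty Finset.univ_nonempty fun i _ => ?_
  refine div_one_add_lt_div_one_add
    (tsum_nonneg fun m => mul_nonneg (ha i m) (by positivity)) ?_
  obtain ⟨m, hm⟩ := hpos i
  exact Summable.tsum_lt_tsum (i := m)
    (fun m => mul_le_mul_of_nonneg_left (by gcongr) (ha i m))
    (mul_lt_mul_of_pos_left (by gcongr) hm)
    (summable_pow_of_le (ha i) hy hyz.le (hs i)) (hs i)

theorem continuousOn_ratioSum (ha : ∀ i m, 0 ≤ a i m) {z : ℝ}
    (hs : ∀ i, Summable fun m => a i m * z ^ (m + 1)) :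
    ContinuousOn (ratioSum a) (Set.Icc 0 z) := by
  have hc : ∀ i, ContinuousOn (fun y : ℝ => ∑' m, a i m * y ^ (m + 1)) (Set.Icc 0 z) := by
    intro i
    refine continuousOn_tsum (fun m => by fun_prop) (hs i) fun m y hy => ?_
    rw [Real.norm_of_nonneg (mul_nonneg (ha i m) (pow_nonneg hy.1 _))]
    exact mul_le_mul_of_nonneg_left (pow_le_pow_left₀ hy.1 hy.2 _) (ha i m)
  unfold ratioSum
  refine continuousOn_finsetSum _ fun i _ => ContinuousOn.div (hc i)
    (continuousOn_const.add (hc i)) fun y hy => ?_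
  have : 0 ≤ ∑' m, a i m * y ^ (m + 1) :=
    tsum_nonneg fun m => mul_nonneg (ha i m) (pow_nonneg hy.1 _)
  positivity

/-- If `s / (1 + s) + t / (1 + t) ≤ 1` then `s * t ≤ 1`. A second factor, whose partial sums are
eventually at least some `e > 0`, thus bounds those of the `i`-th one by `1 / e`. -/
theorem summable_of_truncRatioSum_le_one [Nontrivial ι] (ha : ∀ i m, 0 ≤ a i m)
    (hpos : ∀ i, ∃ m, 0 < a i m) {z : ℝ} (hz : 0 < z) (h : ∀ n, truncRatioSum a n z ≤ 1) (i : ι) :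
    Summable fun m => a i m * z ^ (m + 1) := by
  classical
  have hnn : ∀ j m, 0 ≤ a j m * z ^ (m + 1) := fun j m => mul_nonneg (ha j m) (by positivity)
  obtain ⟨j, hj⟩ := exists_ne i
  obtain ⟨m₀, hm₀⟩ := hpos j
  set e := a j m₀ * z ^ (m₀ + 1) with he
  have he0 : 0 < e := by positivity
  refine summable_of_sum_range_le (c := 1 / e) (hnn i) fun n => ?_
  set N := max n (m₀ + 1)
  set T : ι → ℝ := fun k => ∑ m ∈ Finset.range N, a k m * z ^ (m + 1) with hT
  have hT0 : ∀ k, 0 ≤ T k := fun k => Finset.sum_nonneg fun m _ => hnn k m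
  have h1 : ∑ m ∈ Finset.range n, a i m * z ^ (m + 1) ≤ T i :=
    Finset.sum_le_sum_of_subset_of_nonneg
      (Finset.range_subset_range.2 (le_max_left _ _)) fun m _ _ => hnn i m
  have h2 : e ≤ T j := Finset.single_le_sum (f := fun m => a j m * z ^ (m + 1))
    (fun m _ => hnn j m) (Finset.mem_range.2 (lt_of_lt_of_le (Nat.lt_succ_self _) (le_max_right _ _)))
  have h3 : T i / (1 + T i) + T j / (1 + T j) ≤ 1 := by
    refine le_trans ?_ (h N)
    rw [← Finset.sum_pair hj.symm (f := fun k => T k / (1 + T k))]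
    exact Finset.sum_le_sum_of_subset_of_nonneg (Finset.subset_univ _)
      fun k _ _ => div_one_add_nonneg (hT0 k)
  refine h1.trans ?_
  have hi := hT0 i
  have h4 : T i * T j ≤ 1 := by
    rw [div_add_div _ _ (by linarith) (by linarith), div_le_one (by nlinarith)] at h3
    nlinarith
  rw [le_div_iff₀ he0]
  nlinarith

/-- Existence of the smallest root of `∑ E i / (1 + E i) = 1`, and the behaviour of the sum on
both sides of it. -/
theorem exists_root_ratioSum [Nontrivial ι] (ha : ∀ i m, 0 ≤ a i m) (hpos : ∀ i, ∃ m, 0 < a i m)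
    (hext : ∀ i, ∀ z : ℝ, 0 ≤ z → (Summable fun m => a i m * z ^ (m + 1)) →
      ∃ y, z < y ∧ Summable fun m => a i m * y ^ (m + 1))
    (hone : ∃ n, 1 < truncRatioSum a n 1) :
    ∃ z : ℝ, 0 < z ∧ z < 1 ∧ (∀ i, Summable fun m => a i m * z ^ (m + 1)) ∧ ratioSum a z = 1 ∧
      (∀ y, 0 < y → y < z → ratioSum a y < 1) ∧
      (∀ y, z < y → y < 1 → ∃ n, 1 < truncRatioSum a n y) := by
  -- Truncations are continuous on all of `[0, ∞)` whether or not the series converge, so `Z` is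
  -- compact. Its maximum is the root, and convergence there is a consequence of membership.
  set Z : Set ℝ := ⋂ n, (Set.Icc 0 1 ∩ truncRatioSum a n ⁻¹' Set.Iic 1) with hZ
  have hmem : ∀ z, z ∈ Z ↔ (0 ≤ z ∧ z ≤ 1) ∧ ∀ n, truncRatioSum a n z ≤ 1 := by
    intro z
    simp only [hZ, Set.mem_iInter, Set.mem_inter_iff, Set.mem_Icc, Set.mem_preimage, Set.mem_Iic]
    exact ⟨fun h => ⟨(h 0).1, fun n => (h n).2⟩, fun h n => ⟨h.1, h.2 n⟩⟩
  have hcl : IsClosed Z := isClosed_iInter fun n =>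
    ((continuousOn_truncRatioSum ha n).mono fun x hx => hx.1).preimage_isClosed_of_isClosed
      isClosed_Icc isClosed_Iic
  have hcomp : IsCompact Z :=
    isCompact_Icc.of_isClosed_subset hcl fun z hz => ((hmem z).1 hz).1
  have h0 : (0 : ℝ) ∈ Z := (hmem 0).2 ⟨⟨le_rfl, zero_le_one⟩, fun n => by simp [truncRatioSum]⟩
  obtain ⟨z, hzZ, hzmax⟩ := hcomp.exists_isGreatest ⟨0, h0⟩
  obtain ⟨⟨hz0, hz1⟩, hzn⟩ := (hmem z).1 hzZ
  have hzlt : z < 1 := by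
    refine lt_of_le_of_ne hz1 fun h => ?_
    obtain ⟨n, hn⟩ := hone
    exact (hn.trans_le (h ▸ hzn n)).false
  have hs : ∀ i, Summable fun m => a i m * z ^ (m + 1) := by
    intro i
    rcases hz0.eq_or_lt with h | h
    · simp [← h, summable_zero]
    · exact summable_of_truncRatioSum_le_one ha hpos h hzn i
  have hle : ratioSum a z ≤ 1 := le_of_tendsto' (tendsto_truncRatioSum ha hz0 hs) hzn
  have heq : ratioSum a z = 1 := by
    refine le_antisymm hle (not_lt.1 fun hlt => ?_)
    -- With a sum below `1` at `z`, all series would converge up to a common point beyond `z`, and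
    -- continuity would place larger points in `Z`.
    choose y hy hys using fun i => hext i z hz0 (hs i)
    obtain ⟨i₀, hi₀⟩ := Finite.exists_min y
    have hys' : ∀ i, Summable fun m => a i m * y i₀ ^ (m + 1) := fun i =>
      summable_pow_of_le (ha i) (hz0.trans (hy i₀).le) (hi₀ i) (hys i)
    have hcont := (continuousOn_ratioSum ha hys').continuousWithinAt (x := z) ⟨hz0, (hy i₀).le⟩
    have hev : ∀ᶠ x in 𝓝[>] z, ratioSum a x < 1 := by
      have h1 := hcont.eventually (gt_mem_nhds hlt)
      refine h1.filter_mono (nhdsWithin_le_of_mem ?_)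
      filter_upwards [Ioo_mem_nhdsGT (hy i₀)] with x hx
      exact ⟨hz0.trans hx.1.le, hx.2.le⟩
    obtain ⟨x, hx, hx1, hx2⟩ := (hev.and
      ((show ∀ᶠ x in 𝓝[>] z, x ∈ Set.Ioo z (y i₀) from Ioo_mem_nhdsGT (hy i₀)).and
        (show ∀ᶠ x in 𝓝[>] z, x ∈ Set.Ioo z 1 from Ioo_mem_nhdsGT hzlt))).exists
    have hxZ : x ∈ Z := (hmem x).2 ⟨⟨hz0.trans hx1.1.le, hx2.2.le⟩, fun n =>
      (truncRatioSum_le_ratioSum ha (hz0.trans hx1.1.le)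
        (fun i => summable_pow_of_le (ha i) (hz0.trans hx1.1.le) hx1.2.le (hys' i)) n).trans hx.le⟩
    exact (hzmax hxZ).not_gt hx1.1
  have hzpos : 0 < z := by
    refine lt_of_le_of_ne hz0 fun h => ?_
    rw [← h] at heq
    simp [ratioSum] at heq
  refine ⟨z, hzpos, hzlt, hs, heq, fun y hy hyz => ?_, fun y hzy hy1 => ?_⟩
  · rw [← heq]
    exact ratioSum_lt_ratioSum ha hpos hy.le hyz hs
  · by_contra! hcon
    exact (hzmax ((hmem y).2 ⟨⟨(hz0.trans hzy.le), hy1.le⟩, hcon⟩)).not_gt hzy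

end RatioSum

/-! ### Power series with submultiplicative coefficients -/

section Submultiplicative

/-- Writing `k = q * n + r` with `r < n` dominates `b` by finitely many geometric series of ratio `b
n`. -/
theorem summable_of_submultiplicative {b : ℕ → ℝ} (hb : ∀ m, 0 ≤ b m)
    (hsub : ∀ m n, b (m + n) ≤ b m * b n) {n : ℕ} (hn : n ≠ 0) (hlt : b n < 1) : Summable b := by
  have : NeZero n := ⟨hn⟩
  have hpow : ∀ q r, b (q * n + r) ≤ b n ^ q * b r := by
    intro q r
    induction q with
    | zero => simp
    | succ q ih =>
      calc b ((q + 1) * n + r) = b (n + (q * n + r)) := by congr 1; ring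
        _ ≤ b n * b (q * n + r) := hsub _ _
        _ ≤ b n * (b n ^ q * b r) := mul_le_mul_of_nonneg_left ih (hb n)
        _ = b n ^ (q + 1) * b r := by ring
  have hprod : Summable fun p : ℕ × Fin n => b n ^ p.1 * b p.2 :=
    (summable_geometric_of_lt_one (hb n) hlt).mul_of_nonneg
      (Summable.of_finite (f := fun r : Fin n => b r)) (fun q => pow_nonneg (hb n) q)
      fun r => hb r
  rw [← (Nat.divModEquiv n).symm.summable_iff]
  refine hprod.of_nonneg_of_le (fun p => hb _) fun p => ?_
  simpa [Nat.divModEquiv] using hpow p.1 p.2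

/-- Convergence at `z` makes some term less than `1`. By continuity that term stays below `1`
slightly to the right, where submultiplicativity again gives geometric decay. -/
theorem exists_gt_summable_of_submultiplicative {c : ℕ → ℝ} (hc : ∀ m, 0 ≤ c m)
    (hsub : ∀ m n, c (m + n) ≤ c m * c n) {z : ℝ} (hz : 0 ≤ z)
    (hs : Summable fun m => c (m + 1) * z ^ (m + 1)) :
    ∃ y, z < y ∧ Summable fun m => c (m + 1) * y ^ (m + 1) := by
  obtain ⟨m, hm⟩ := (hs.tendsto_atTop_zero.eventually (gt_mem_nhds one_pos)).exists
  have hcont : Continuous fun y : ℝ => c (m + 1) * y ^ (m + 1) := by fun_prop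
  have hev : ∀ᶠ y in 𝓝[>] z, c (m + 1) * y ^ (m + 1) < 1 :=
    nhdsWithin_le_nhds (hcont.continuousAt.eventually (gt_mem_nhds hm))
  obtain ⟨y, hy1, hy⟩ := (hev.and self_mem_nhdsWithin).exists
  have hy0 : 0 ≤ y := hz.trans (le_of_lt hy)
  refine ⟨y, hy, (summable_nat_add_iff 1 (f := fun m => c m * y ^ m)).2 ?_⟩
  refine summable_of_submultiplicative (fun k => mul_nonneg (hc k) (by positivity))
    (fun k l => ?_) (Nat.succ_ne_zero m) hy1
  calc c (k + l) * y ^ (k + l) ≤ (c k * c l) * y ^ (k + l) :=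
        mul_le_mul_of_nonneg_right (hsub k l) (by positivity)
    _ = _ := by rw [pow_add]; ring

end Submultiplicative

/-! ### Distances in graphs -/

section GraphDistance

variable {V W : Type*} {X : SimpleGraph V} {Y : SimpleGraph W}

theorem le_add_dist_of_lipschitz (hX : X.Connected) {f : V → ℕ}
    (hf : ∀ u v, X.Adj u v → f v ≤ f u + 1) (u v : V) : f v ≤ f u + X.dist u v := by
  obtain ⟨p, hp⟩ := hX.exists_walk_length_eq_dist u v
  rw [← hp]
  clear hp
  induction p with
  | nil => simp
  | cons h p ih =>
    have := hf _ _ h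
    rw [SimpleGraph.Walk.length_cons]
    omega

theorem dist_map_le_dist (hX : X.Connected) (hY : Y.Connected) {f : V → W}
    (hf : ∀ u v, X.Adj u v → Y.dist (f u) (f v) ≤ 1) (u v : V) :
    Y.dist (f u) (f v) ≤ X.dist u v := by
  have := le_add_dist_of_lipschitz (f := fun w => Y.dist (f u) (f w)) hX
    (fun w w' h => (hY.dist_triangle (v := f w)).trans (Nat.add_le_add_left (hf w w' h) _)) u v
  simpa using this

theorem exists_adj_dist_add_one_eq (hX : X.Connected) {u v : V} {n : ℕ} (h : X.dist u v = n + 1) :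
    ∃ w, X.Adj u w ∧ X.dist w v = n := by
  obtain ⟨p, hp⟩ := hX.exists_walk_length_eq_dist u v
  cases p with
  | nil => simp at h
  | @cons _ w _ hadj q =>
    refine ⟨w, hadj, le_antisymm ?_ ?_⟩
    · have := SimpleGraph.dist_le q
      rw [SimpleGraph.Walk.length_cons] at hp
      omega
    · have h1 := hX.dist_triangle (u := u) (v := w) (w := v)
      rw [SimpleGraph.dist_eq_one_iff_adj.2 hadj] at h1
      omega

theorem exists_dist_eq_dist_eq (hX : X.Connected) {u v : V} {m n : ℕ} (h : X.dist u v = m + n) :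
    ∃ w, X.dist u w = m ∧ X.dist w v = n := by
  induction m generalizing u with
  | zero => exact ⟨u, by simp, by simpa using h⟩
  | succ m ih =>
    obtain ⟨u', hadj, hu'⟩ := exists_adj_dist_add_one_eq hX (n := m + n) (by rw [h]; ring)
    obtain ⟨w, hw1, hw2⟩ := ih hu'
    have h1 := SimpleGraph.dist_eq_one_iff_adj.2 hadj
    have h2 := hX.dist_triangle (u := u) (v := u') (w := w)
    have h3 := hX.dist_triangle (u := u) (v := w) (w := v)
    exact ⟨w, by omega, hw2⟩

end GraphDistance

/-! ### Reduced words in free products -/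

section ReducedWords

open Monoid

variable {ι : Type*} {G : ι → Type*} [∀ i, Group (G i)]

/-- A list of letters is reduced if all letters are nontrivial and consecutive letters lie in
different factors. -/
def IsReducedWord (L : List (Σ i, G i)) : Prop :=
  (∀ a ∈ L, a.2 ≠ 1) ∧ L.IsChain fun a b => a.1 ≠ b.1

/-- The element of the free product represented by a list of letters. -/
def listProd (L : List (Σ i, G i)) : CoprodI G :=
  (L.map fun a => CoprodI.of a.2).prod

open Classical in
/-- The reduced word of an element of the free product. -/
noncomputable def reducedWord (x : CoprodI G) : List (Σ i, G i) :=
  (CoprodI.Word.equiv x).toList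

/-- The word with the single letter `g`, or the empty word if `g = 1`. -/
noncomputable def letterWord (i : ι) (g : G i) : List (Σ i, G i) :=
  open Classical in if g = 1 then [] else [⟨i, g⟩]

@[simp]
theorem listProd_nil : listProd ([] : List (Σ i, G i)) = 1 := rfl

@[simp]
theorem listProd_cons (a : Σ i, G i) (L : List (Σ i, G i)) :
    listProd (a :: L) = CoprodI.of a.2 * listProd L := rfl

@[simp]
theorem listProd_append (L M : List (Σ i, G i)) :
    listProd (L ++ M) = listProd L * listProd M := by
  simp [listProd]

@[simp]
theorem listProd_letterWord (i : ι) (g : G i) : listProd (letterWord i g) = CoprodI.of g := by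
  unfold letterWord
  split_ifs with h <;> simp [h]

theorem isReduced_reducedWord (x : CoprodI G) : IsReducedWord (reducedWord x) := by
  classical
  exact ⟨(CoprodI.Word.equiv x).ne_one, (CoprodI.Word.equiv x).chain_ne⟩

@[simp]
theorem listProd_reducedWord (x : CoprodI G) : listProd (reducedWord x) = x := by
  classical
  exact CoprodI.Word.equiv.symm_apply_apply x

theorem reducedWord_injective : Function.Injective (reducedWord (G := G)) := fun x y h => by
  rw [← listProd_reducedWord x, h, listProd_reducedWord]

theorem reducedWord_listProd {L : List (Σ i, G i)} (hL : IsReducedWord L) :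
    reducedWord (listProd L) = L := by
  classical
  exact congrArg CoprodI.Word.toList
    (CoprodI.Word.equiv.apply_symm_apply (⟨L, hL.1, hL.2⟩ : CoprodI.Word G))

theorem IsReducedWord.of_append_left {L M : List (Σ i, G i)} (h : IsReducedWord (L ++ M)) :
    IsReducedWord L :=
  ⟨fun a ha => h.1 a (List.mem_append_left _ ha), h.2.left_of_append⟩

theorem IsReducedWord.append_letterWord {P : List (Σ i, G i)} (hP : IsReducedWord P) {i : ι}
    (hi : ∀ a ∈ P.getLast?, a.1 ≠ i) (g : G i) : IsReducedWord (P ++ letterWord i g) := by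
  unfold letterWord
  split_ifs with h
  · simpa using hP
  · refine ⟨fun a ha => ?_, hP.2.append (List.isChain_singleton _) ?_⟩
    · rcases List.mem_append.1 ha with ha | ha
      · exact hP.1 a ha
      · rw [List.mem_singleton.1 ha]
        exact h
    · intro a ha b hb
      simp only [List.head?_cons, Option.mem_def, Option.some.injEq] at hb
      rw [← hb]
      exact hi a ha

theorem IsReducedWord.exists_eq_append_letterWord {L : List (Σ i, G i)} (hL : IsReducedWord L) (i : ι) :
    ∃ (P : List (Σ i, G i)) (g : G i), L = P ++ letterWord i g ∧ ∀ a ∈ P.getLast?, a.1 ≠ i := by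
  rcases List.eq_nil_or_concat L with rfl | ⟨P, ⟨j, g⟩, rfl⟩
  · exact ⟨[], 1, by simp [letterWord], by simp⟩
  · by_cases hij : j = i
    · subst hij
      have hg : g ≠ 1 := hL.1 ⟨j, g⟩ (by simp)
      refine ⟨P, g, by simp [letterWord, hg], fun a ha => ?_⟩
      have := hL.2
      rw [List.concat_eq_append, List.isChain_append] at this
      exact this.2.2 a ha ⟨j, g⟩ (by simp)
    · exact ⟨P.concat ⟨j, g⟩, 1, by simp [letterWord], by simpa using hij⟩

/-- Since the split-off last letter from the factor `i` may be trivial, appending, changing and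
cancelling a letter all become the single rule `g ↦ g * s`. -/
theorem exists_reducedWord_mul_of (x : CoprodI G) (i : ι) (s : G i) :
    ∃ P g, reducedWord x = P ++ letterWord i g ∧
      reducedWord (x * CoprodI.of s) = P ++ letterWord i (g * s) := by
  obtain ⟨P, g, hx, hP⟩ := (isReduced_reducedWord x).exists_eq_append_letterWord i
  have hPr : IsReducedWord P := (hx ▸ isReduced_reducedWord x).of_append_left
  refine ⟨P, g, hx, ?_⟩
  rw [← reducedWord_listProd (hPr.append_letterWord hP (g * s))]
  congr 1
  rw [← listProd_reducedWord x, hx]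
  simp [mul_assoc]

/-- Multiplication by an element of a factor leaves the set of elements whose reduced word starts
with `w` only from the element represented by `w`. -/
theorem eq_of_prefix_of_not_prefix {x : CoprodI G} {i : ι} {s : G i} {w : List (Σ i, G i)}
    (hx : w <+: reducedWord x) (hxs : ¬ w <+: reducedWord (x * CoprodI.of s)) :
    w = reducedWord x := by
  obtain ⟨P, g, h1, h2⟩ := exists_reducedWord_mul_of x i s
  rw [h1] at hx ⊢
  rw [h2] at hxs
  have hP : ¬ w <+: P := fun h => hxs (h.trans (List.prefix_append _ _))
  unfold letterWord at hx ⊢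
  split_ifs at hx ⊢ with hg
  · simp only [List.append_nil] at hx
    exact absurd hx hP
  · rw [List.prefix_concat_iff] at hx
    rcases hx with hx | hx
    · exact hx
    · exact absurd hx hP

end ReducedWords

/-! ### Lengths in free products -/

section FreeProductLength

open Monoid

variable {ι : Type*} {G : ι → Type*} [∀ i, Group (G i)] {S : ∀ i, Set (G i)}

theorem freeProductGraph_adj_iff (hsymm : ∀ i, ∀ s ∈ S i, s⁻¹ ∈ S i) {u v : CoprodI G} :
    (freeProductGraph S).Adj u v ↔ u ≠ v ∧ ∃ i, ∃ s ∈ S i, v = u * CoprodI.of s := by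
  rw [freeProductGraph, SimpleGraph.mulCayley_adj]
  refine and_congr_right fun _ => ⟨?_, ?_⟩
  · simp only [Set.mem_iUnion, Set.mem_image]
    rintro (⟨i, s, hs, h⟩ | ⟨i, s, hs, h⟩)
    · exact ⟨i, s, hs, by rw [h]; group⟩
    · refine ⟨i, s⁻¹, hsymm i s hs, ?_⟩
      rw [map_inv, h]
      group
  · rintro ⟨i, s, hs, rfl⟩
    exact Or.inl (Set.mem_iUnion.2 ⟨i, s, hs, by group⟩)

theorem freeProductGraph_adj_mul_left (a u v : CoprodI G) :
    (freeProductGraph S).Adj (a * u) (a * v) ↔ (freeProductGraph S).Adj u v :=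
  SimpleGraph.mulCayley_adj_mul_iff_right

/-- Left multiplication as an automorphism of the Cayley graph. -/
def freeProductGraphMulLeft (S : ∀ i, Set (G i)) (a : CoprodI G) :
    freeProductGraph S →g freeProductGraph S where
  toFun := (a * ·)
  map_rel' h := (freeProductGraph_adj_mul_left a _ _).2 h

/-- By left invariance the elements reachable from `1` form a subgroup, and it contains every
generator. -/
theorem freeProductGraph_connected (hgen : ∀ i, Subgroup.closure (S i) = ⊤) :
    (freeProductGraph S).Connected := by
  have hmul : ∀ a u v, (freeProductGraph S).Reachable u v →
      (freeProductGraph S).Reachable (a * u) (a * v) := fun a u v h =>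
    h.map (freeProductGraphMulLeft S a)
  let H : Subgroup (CoprodI G) :=
    { carrier := {x | (freeProductGraph S).Reachable 1 x}
      one_mem' := SimpleGraph.Reachable.refl _
      mul_mem' := fun {x y} hx hy => by
        have := hmul x 1 y hy
        rw [mul_one] at this
        exact SimpleGraph.Reachable.trans hx this
      inv_mem' := fun {x} hx => by
        have := hmul x⁻¹ 1 x hx
        rw [mul_one, inv_mul_cancel] at this
        exact this.symm }
  have hof : ∀ i, ∀ g : G i, CoprodI.of g ∈ H := by
    intro i g
    have : Subgroup.closure (S i) ≤ H.comap CoprodI.of := by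
      rw [Subgroup.closure_le]
      intro s hs
      change (freeProductGraph S).Reachable 1 (CoprodI.of s)
      by_cases h : (1 : CoprodI G) = CoprodI.of s
      · rw [← h]
      · refine SimpleGraph.Adj.reachable ?_
        rw [freeProductGraph, SimpleGraph.mulCayley_adj]
        exact ⟨h, Or.inl (Set.mem_iUnion.2 ⟨i, s, hs, by simp⟩)⟩
    rw [hgen i] at this
    exact this (Subgroup.mem_top g)
  have hall : ∀ x : CoprodI G, x ∈ H := fun x => by
    induction x using CoprodI.induction_on with
    | one => exact H.one_mem
    | of i m => exact hof i m
    | mul x y hx hy => exact H.mul_mem hx hy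
  have : Nonempty (CoprodI G) := ⟨1⟩
  exact SimpleGraph.Connected.mk fun u v =>
    (SimpleGraph.Reachable.symm (hall u)).trans (hall v)

theorem freeProductGraph_dist_mul_left (hgen : ∀ i, Subgroup.closure (S i) = ⊤)
    (a u v : CoprodI G) :
    (freeProductGraph S).dist (a * u) (a * v) = (freeProductGraph S).dist u v := by
  have hc := freeProductGraph_connected hgen
  have h : ∀ a u v : CoprodI G,
      (freeProductGraph S).dist (a * u) (a * v) ≤ (freeProductGraph S).dist u v := fun a u v =>
    dist_map_le_dist hc hc (f := (a * ·)) (fun u v huv => by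
      rw [SimpleGraph.dist_eq_one_iff_adj.2 ((freeProductGraph_adj_mul_left a u v).2 huv)]) u v
  refine le_antisymm (h a u v) ?_
  simpa using h a⁻¹ (a * u) (a * v)

theorem freeProductLength_inv_mul (hgen : ∀ i, Subgroup.closure (S i) = ⊤) (u v : CoprodI G) :
    freeProductLength S (u⁻¹ * v) = (freeProductGraph S).dist u v := by
  rw [freeProductLength, ← freeProductGraph_dist_mul_left hgen u]
  simp

theorem freeProductLength_mul_le (hgen : ∀ i, Subgroup.closure (S i) = ⊤) (u v : CoprodI G) :
    freeProductLength S (u * v) ≤ freeProductLength S u + freeProductLength S v := by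
  have h := (freeProductGraph_connected hgen).dist_triangle (u := 1) (v := u) (w := u * v)
  rwa [← freeProductLength_inv_mul hgen u, inv_mul_cancel_left] at h

@[simp]
theorem freeProductLength_one : freeProductLength S 1 = 0 := SimpleGraph.dist_self

theorem freeProductLength_eq_zero (hgen : ∀ i, Subgroup.closure (S i) = ⊤) {x : CoprodI G} :
    freeProductLength S x = 0 ↔ x = 1 := by
  rw [freeProductLength, (freeProductGraph_connected hgen).dist_eq_zero_iff, eq_comm]

theorem freeProductLength_of_le_one {i : ι} {s : G i} (hs : s ∈ S i) :
    freeProductLength S (CoprodI.of s) ≤ 1 := by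
  by_cases h : (1 : CoprodI G) = CoprodI.of s
  · simp [← h]
  · refine (SimpleGraph.dist_eq_one_iff_adj.2 ?_).le
    rw [freeProductGraph, SimpleGraph.mulCayley_adj]
    exact ⟨h, Or.inl (Set.mem_iUnion.2 ⟨i, s, hs, by simp⟩)⟩

/-- The sum of the lengths of the letters of a word. -/
noncomputable def listLength (S : ∀ i, Set (G i)) (L : List (Σ i, G i)) : ℕ :=
  (L.map fun a => freeProductLength S (CoprodI.of a.2)).sum

@[simp]
theorem listLength_nil : listLength S [] = 0 := rfl

@[simp]
theorem listLength_cons (a : Σ i, G i) (L : List (Σ i, G i)) :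
    listLength S (a :: L) = freeProductLength S (CoprodI.of a.2) + listLength S L := by
  simp [listLength]

@[simp]
theorem listLength_append (L M : List (Σ i, G i)) :
    listLength S (L ++ M) = listLength S L + listLength S M := by
  simp [listLength]

@[simp]
theorem listLength_letterWord (i : ι) (g : G i) :
    listLength S (letterWord i g) = freeProductLength S (CoprodI.of g) := by
  unfold letterWord
  split_ifs with h <;> simp [h]

theorem freeProductLength_listProd_le (hgen : ∀ i, Subgroup.closure (S i) = ⊤)
    (L : List (Σ i, G i)) : freeProductLength S (listProd L) ≤ listLength S L := by
  induction L with
  | nil => simp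
  | cons a L ih =>
    rw [listProd_cons, listLength_cons]
    exact (freeProductLength_mul_le hgen _ _).trans (Nat.add_le_add_left ih _)

/-- An edge multiplies at most the last letter by a generator, so the sum of letter lengths grows by
at most `1` along it and is bounded by the distance from `1`. -/
theorem listLength_reducedWord (hsymm : ∀ i, ∀ s ∈ S i, s⁻¹ ∈ S i)
    (hgen : ∀ i, Subgroup.closure (S i) = ⊤) (x : CoprodI G) :
    listLength S (reducedWord x) = freeProductLength S x := by
  refine le_antisymm ?_ ?_
  · have h := le_add_dist_of_lipschitz (freeProductGraph_connected hgen)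
      (f := fun x => listLength S (reducedWord x)) (fun u v huv => ?_) 1 x
    · have h1 : reducedWord (1 : CoprodI G) = [] :=
        reducedWord_listProd (L := []) ⟨by simp, List.isChain_nil⟩
      simpa [h1, freeProductLength] using h
    · obtain ⟨-, i, s, hs, rfl⟩ := (freeProductGraph_adj_iff hsymm).1 huv
      obtain ⟨P, g, h1, h2⟩ := exists_reducedWord_mul_of u i s
      simp only [h1, h2, listLength_append, listLength_letterWord, map_mul]
      have := freeProductLength_mul_le hgen (CoprodI.of g) (CoprodI.of s)
      have := freeProductLength_of_le_one (S := S) hs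
      omega
  · simpa using freeProductLength_listProd_le hgen (reducedWord x)

theorem freeProductLength_listProd (hsymm : ∀ i, ∀ s ∈ S i, s⁻¹ ∈ S i)
    (hgen : ∀ i, Subgroup.closure (S i) = ⊤) {L : List (Σ i, G i)} (hL : IsReducedWord L) :
    freeProductLength S (listProd L) = listLength S L := by
  rw [← listLength_reducedWord hsymm hgen, reducedWord_listProd hL]

theorem finite_freeProductLength_le [Finite ι] (hfinite : ∀ i, (S i).Finite)
    (hsymm : ∀ i, ∀ s ∈ S i, s⁻¹ ∈ S i) (hgen : ∀ i, Subgroup.closure (S i) = ⊤) (m : ℕ) :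
    {x : CoprodI G | freeProductLength S x ≤ m}.Finite := by
  induction m with
  | zero =>
    refine (Set.finite_singleton 1).subset fun x hx => ?_
    exact (freeProductLength_eq_zero hgen).1 (Nat.le_zero.1 hx)
  | succ m ih =>
    have hT : (⋃ i, (CoprodI.of : G i →* CoprodI G) '' S i).Finite :=
      Set.finite_iUnion fun i => (hfinite i).image _
    refine (ih.union (ih.image2 (· * ·) hT)).subset fun x hx => ?_
    rcases Nat.lt_or_ge m (freeProductLength S x) with h | h
    · have hx' : freeProductLength S x = m + 1 := le_antisymm hx h
      obtain ⟨y, hy1, hy2⟩ := exists_dist_eq_dist_eq (freeProductGraph_connected hgen) hx'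
      obtain ⟨-, i, s, hs, rfl⟩ :=
        (freeProductGraph_adj_iff hsymm).1 (SimpleGraph.dist_eq_one_iff_adj.1 hy2)
      exact Or.inr ⟨y, hy1.le, CoprodI.of s, Set.mem_iUnion.2 ⟨i, s, hs, rfl⟩, rfl⟩
    · exact Or.inl h

theorem finite_length_factor_le [Finite ι] (hfinite : ∀ i, (S i).Finite)
    (hsymm : ∀ i, ∀ s ∈ S i, s⁻¹ ∈ S i) (hgen : ∀ i, Subgroup.closure (S i) = ⊤) (i : ι) (m : ℕ) :
    {x : G i | freeProductLength S (CoprodI.of x) ≤ m}.Finite :=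
  (finite_freeProductLength_le hfinite hsymm hgen m).preimage (CoprodI.of_injective i).injOn

/-- The retraction onto a factor does not increase distances. -/
theorem exists_factor_retraction (hsymm : ∀ i, ∀ s ∈ S i, s⁻¹ ∈ S i)
    (hgen : ∀ i, Subgroup.closure (S i) = ⊤) (i : ι) :
    ∃ π : CoprodI G →* G i, (∀ g, π (CoprodI.of g) = g) ∧ ∀ u v,
      (freeProductGraph S).dist (CoprodI.of (π u)) (CoprodI.of (π v))
        ≤ (freeProductGraph S).dist u v := by
  classical
  have hc := freeProductGraph_connected hgen
  let π : CoprodI G →* G i := CoprodI.lift (Pi.mulSingle i (MonoidHom.id (G i)))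
  refine ⟨π, CoprodI.of_leftInverse i, fun u v => dist_map_le_dist hc hc
    (f := fun x => CoprodI.of (π x)) (fun u v huv => ?_) u v⟩
  obtain ⟨-, j, s, hs, rfl⟩ := (freeProductGraph_adj_iff hsymm).1 huv
  rw [← freeProductLength_inv_mul hgen, map_mul, map_mul, inv_mul_cancel_left]
  by_cases hij : j = i
  · subst hij
    rw [show π (CoprodI.of s) = s from CoprodI.of_leftInverse j s]
    exact freeProductLength_of_le_one hs
  · have : π (CoprodI.of s) = 1 := by
      simp [π, CoprodI.lift_of, Pi.mulSingle_eq_of_ne hij]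
    simp [this]

/-- A geodesic from `1` to `x` has a point `y` at distance `m`, possibly outside the factor. The
retraction moves `y` into the factor without increasing either distance, and the triangle inequality
makes them exactly `m` and `n`. -/
theorem sphereCount_add_le [Finite ι] (hfinite : ∀ i, (S i).Finite)
    (hsymm : ∀ i, ∀ s ∈ S i, s⁻¹ ∈ S i) (hgen : ∀ i, Subgroup.closure (S i) = ⊤)
    (i : ι) (m n : ℕ) :
    sphereCount S i (m + n) ≤ sphereCount S i m * sphereCount S i n := by
  obtain ⟨π, hπ, hlip⟩ := exists_factor_retraction hsymm hgen i
  have hc := freeProductGraph_connected hgen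
  have hfin : ∀ k, {x : G i | freeProductLength S (CoprodI.of x) = k}.Finite := fun k =>
    (finite_length_factor_le hfinite hsymm hgen i k).subset fun x hx => le_of_eq hx
  unfold sphereCount
  rw [← Set.ncard_prod]
  refine (Set.ncard_le_ncard ?_ (((hfin m).prod (hfin n)).image fun p => p.1 * p.2)).trans
    (Set.ncard_image_le ((hfin m).prod (hfin n)))
  intro x hx
  obtain ⟨y, hy1, hy2⟩ := exists_dist_eq_dist_eq hc (show
    (freeProductGraph S).dist 1 (CoprodI.of x) = m + n from hx)
  have h1 := hlip 1 y
  have h2 := hlip y (CoprodI.of x)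
  rw [map_one, map_one] at h1
  rw [hπ] at h2
  have h3 := hc.dist_triangle (u := 1) (v := CoprodI.of (π y)) (w := CoprodI.of x)
  have h4 : (freeProductGraph S).dist 1 (CoprodI.of x) = m + n := hx
  refine ⟨(π y, (π y)⁻¹ * x), ⟨?_, ?_⟩, by simp⟩
  · change (freeProductGraph S).dist 1 (CoprodI.of (π y)) = m
    omega
  · change freeProductLength S (CoprodI.of ((π y)⁻¹ * x)) = n
    rw [map_mul, map_inv, freeProductLength_inv_mul hgen]
    omega

end FreeProductLength

/-! ### Ends of connected locally finite graphs -/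

section EndsOfGraph

variable {V : Type*} {X : SimpleGraph V} {o : V}

theorem ballBelow_mono {m n : ℕ} (h : m ≤ n) : ballBelow X o m ⊆ ballBelow X o n :=
  fun _ hx => lt_of_lt_of_le hx h

theorem RootedRay.eventually_notMem (r : RootedRay X o) {A : Set V} (hA : A.Finite) :
    ∀ᶠ n in atTop, r.vertex n ∉ A := by
  have := r.injective.tendsto_cofinite.eventually hA.compl_mem_cofinite
  rwa [Nat.cofinite_eq_atTop] at this

/-- The ray leaves the finite ball for good, and its tail stays in one component. At the first time
`N` from which it stays outside, the distance is exactly `m`: either `N = 0`, or the preceding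
vertex is in the ball. This vertex later lets spheres bound the number of components. -/
theorem RootedRay.exists_eventually_mem_componentCompl (hX : X.Connected)
    (hfin : ∀ m, (ballBelow X o m).Finite) (r : RootedRay X o) (m : ℕ) :
    ∃ C : X.ComponentCompl (ballBelow X o m),
      (∃ v ∈ C, X.dist o v = m) ∧ ∀ᶠ n in atTop, r.vertex n ∈ C := by
  classical
  have hex : ∃ N, ∀ n, N ≤ n → r.vertex n ∉ ballBelow X o m :=
    eventually_atTop.1 (r.eventually_notMem (hfin m))
  set N := Nat.find hex with hN
  have hspec : ∀ n, N ≤ n → r.vertex n ∉ ballBelow X o m := Nat.find_spec hex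
  have hmem : ∀ n, N ≤ n → r.vertex n ∈ X.componentComplMk (hspec N le_rfl) := by
    intro n hn
    induction n, hn using Nat.le_induction with
    | base => exact X.componentComplMk_mem _
    | succ n hn ih =>
      exact SimpleGraph.ComponentCompl.mem_of_adj _ _ ih (hspec _ (hn.trans n.le_succ))
        (r.adj_succ n)
  refine ⟨_, ⟨r.vertex N, hmem N le_rfl, ?_⟩, eventually_atTop.2 ⟨N, hmem⟩⟩
  have hge : m ≤ X.dist o (r.vertex N) := not_lt.1 (hspec N le_rfl)
  refine le_antisymm ?_ hge
  rcases Nat.eq_zero_or_pos N with h0 | hpos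
  · rw [h0, r.vertex_zero, SimpleGraph.dist_self]
    exact Nat.zero_le _
  · obtain ⟨k, hk⟩ := Nat.exists_eq_add_of_lt hpos
    rw [zero_add] at hk
    have hnot := Nat.find_min hex (m := k) (by omega)
    push Not at hnot
    obtain ⟨n, hkn, hn⟩ := hnot
    have hnk : n = k := by
      by_contra hne
      exact hspec n (by omega) hn
    subst hnk
    have h1 : X.dist o (r.vertex n) < m := hn
    have h2 := hX.dist_triangle (u := o) (v := r.vertex n) (w := r.vertex (n + 1))
    rw [SimpleGraph.dist_eq_one_iff_adj.2 (r.adj_succ n)] at h2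
    rw [hk]
    omega

theorem RootedRay.nonempty_inter_of_infinite {r s : RootedRay X o}
    (h : (Set.range r.vertex ∩ Set.range s.vertex).Infinite) {A B : Set V}
    (hr : ∀ᶠ n in atTop, r.vertex n ∈ A) (hs : ∀ᶠ n in atTop, s.vertex n ∈ B) :
    (A ∩ B).Nonempty := by
  obtain ⟨M, hM⟩ := eventually_atTop.1 hr
  obtain ⟨N, hN⟩ := eventually_atTop.1 hs
  obtain ⟨v, ⟨⟨m, hm⟩, ⟨n, hn⟩⟩, hv⟩ := (h.sdiff (((Set.finite_Iio M).image r.vertex).union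
    ((Set.finite_Iio N).image s.vertex))).nonempty
  simp only [Set.mem_union, Set.mem_image, Set.mem_Iio, not_or, not_exists, not_and] at hv
  refine ⟨v, ?_, ?_⟩
  · rw [← hm]
    exact hM m (not_lt.1 fun h => hv.1 m h hm)
  · rw [← hn]
    exact hN n (not_lt.1 fun h => hv.2 n h hn)

theorem SimpleGraph.ComponentCompl.eq_of_mem_of_mem {K : Set V} {C D : X.ComponentCompl K} {v : V}
    (hC : v ∈ C) (hD : v ∈ D) : C = D := by
  obtain ⟨_, rfl⟩ := hC
  obtain ⟨_, rfl⟩ := hD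
  rfl

/-- The tail of the third ray lies in one component and meets the tails of both rays, so all three
components agree. -/
theorem RayEquiv.eventually_mem (hX : X.Connected) (hfin : ∀ m, (ballBelow X o m).Finite)
    {r s : RootedRay X o} (h : RayEquiv r s) {m : ℕ} {C : X.ComponentCompl (ballBelow X o m)}
    (hr : ∀ᶠ n in atTop, r.vertex n ∈ C) : ∀ᶠ n in atTop, s.vertex n ∈ C := by
  obtain ⟨t, htr, hts⟩ := h
  obtain ⟨D, -, hD⟩ := t.exists_eventually_mem_componentCompl hX hfin m
  obtain ⟨F, -, hF⟩ := s.exists_eventually_mem_componentCompl hX hfin m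
  obtain ⟨v, hv1, hv2⟩ := RootedRay.nonempty_inter_of_infinite (A := D) (B := C) htr hD hr
  obtain ⟨w, hw1, hw2⟩ := RootedRay.nonempty_inter_of_infinite (A := D) (B := F) hts hD hF
  rw [← SimpleGraph.ComponentCompl.eq_of_mem_of_mem hv1 hv2,
    SimpleGraph.ComponentCompl.eq_of_mem_of_mem hw1 hw2]
  exact hF

theorem RayEquiv.symm {r s : RootedRay X o} (h : RayEquiv r s) : RayEquiv s r :=
  let ⟨t, h1, h2⟩ := h
  ⟨t, h2, h1⟩

theorem RootedRay.containedIn_toEnd (hX : X.Connected) (hfin : ∀ m, (ballBelow X o m).Finite)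
    {r : RootedRay X o} {m : ℕ} {C : X.ComponentCompl (ballBelow X o m)}
    (hr : ∀ᶠ n in atTop, r.vertex n ∈ C) : r.toEnd.ContainedIn (C : Set V) := by
  intro s hs
  -- Equality in `Quot` only says that the rays are linked by a chain of `RayEquiv`s, so the
  -- predicate is lifted to the quotient.
  have hlift : ∀ r s : RootedRay X o, RayEquiv r s →
      (∀ᶠ n in atTop, r.vertex n ∈ C) = ∀ᶠ n in atTop, s.vertex n ∈ C := fun r s h =>
    propext ⟨h.eventually_mem hX hfin, h.symm.eventually_mem hX hfin⟩
  exact (congrArg (Quot.lift (fun r : RootedRay X o => ∀ᶠ n in atTop, r.vertex n ∈ C) hlift) hs).mpr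
    hr

theorem EndSpace.exists_containedIn (hX : X.Connected) (hfin : ∀ m, (ballBelow X o m).Finite)
    (ω : EndSpace X o) (m : ℕ) :
    ∃ C : X.ComponentCompl (ballBelow X o m),
      ω.ContainedIn (C : Set V) ∧ ∃ v ∈ C, X.dist o v = m := by
  obtain ⟨r, rfl⟩ := Quot.exists_rep ω
  obtain ⟨C, hv, hC⟩ := r.exists_eventually_mem_componentCompl hX hfin m
  exact ⟨C, RootedRay.containedIn_toEnd hX hfin hC, hv⟩

theorem SameComponent.le_confluence {m : ℕ} {ω₁ ω₂ : EndSpace X o} (h : SameComponent m ω₁ ω₂) :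
    (m : ℕ∞) ≤ confluence ω₁ ω₂ :=
  le_iSup₂ (f := fun (m : ℕ) (_ : SameComponent m ω₁ ω₂) => (m : ℕ∞)) m h

/-- A supremum of at least `m` gives some qualifying `n ≥ m`, which suffices as components are
nested. For `m = 0` the inequality carries no information, since an empty supremum is `0` too. -/
theorem exists_sameComponent_of_le_confluence {m : ℕ} (hm : m ≠ 0) {ω₁ ω₂ : EndSpace X o}
    (h : (m : ℕ∞) ≤ confluence ω₁ ω₂) : ∃ n, m ≤ n ∧ SameComponent n ω₁ ω₂ := by
  by_contra! hcon
  have : confluence ω₁ ω₂ ≤ ((m - 1 : ℕ) : ℕ∞) := by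
    refine iSup₂_le fun n hn => ?_
    have : n < m := not_le.1 fun hmn => hcon n hmn hn
    exact_mod_cast Nat.le_sub_one_of_lt this
  have := h.trans this
  norm_cast at this
  omega

theorem SameComponent.endDist_le {α : ℝ} (hα₀ : 0 < α) (hα₁ : α < 1) {m : ℕ}
    {ω₁ ω₂ : EndSpace X o} (h : SameComponent m ω₁ ω₂) : endDist α ω₁ ω₂ ≤ α ^ m := by
  unfold endDist
  split_ifs with htop
  · positivity
  · refine pow_le_pow_of_le_one hα₀.le hα₁.le ?_
    have := h.le_confluence
    rw [← ENat.natCast_toNat htop] at this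
    exact_mod_cast this

/-- Nonzero distances are powers of `α`, so being strictly below `α ^ m` gains a whole level. -/
theorem le_confluence_of_endDist_lt {α : ℝ} (hα₀ : 0 < α) (hα₁ : α < 1) {m : ℕ}
    {ω₁ ω₂ : EndSpace X o} (h : endDist α ω₁ ω₂ < α ^ m) :
    ((m + 1 : ℕ) : ℕ∞) ≤ confluence ω₁ ω₂ := by
  unfold endDist at h
  split_ifs at h with htop
  · rw [htop]
    exact le_top
  · have := (pow_lt_pow_iff_right_of_lt_one₀ hα₀ hα₁).1 h
    rw [← ENat.natCast_toNat htop]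
    exact_mod_cast this

/-- The ends in a set can be covered by as many balls of radius `α ^ m` as there are vertices at
distance `m` from the root. -/
theorem exists_isBallCover_endDist {α : ℝ} (hα₀ : 0 < α) (hα₁ : α < 1) (hX : X.Connected)
    (hfin : ∀ m, (ballBelow X o m).Finite) (A : Set (EndSpace X o)) (m : ℕ) :
    ∃ C : Set (EndSpace X o × ℝ), IsBallCover (endDist α) A C ∧ (∀ p ∈ C, p.2 = α ^ m) ∧
      C.encard ≤ {v | X.dist o v = m}.encard := by
  rcases isEmpty_or_nonempty (EndSpace X o) with _ | _
  · exact ⟨∅, ⟨Set.countable_empty, by simp, fun ω => isEmptyElim ω⟩, by simp, by simp⟩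
  -- Each end gets a vertex at distance `m` in its component. Ends with the same vertex share the
  -- component, so one centre in `A` per attained vertex suffices.
  choose comp hcomp vert hvert hdist using fun ω : EndSpace X o => ω.exists_containedIn hX hfin m
  have hsec : ∀ v ∈ vert '' A, ∃ ω ∈ A, vert ω = v := fun v hv => hv
  choose! sec hsecA hsec using hsec
  have hsub : vert '' A ⊆ {v | X.dist o v = m} := by
    rintro _ ⟨ω, -, rfl⟩
    exact hdist ω
  have hfinite : (vert '' A).Finite := (hfin (m + 1)).subset fun v hv =>
    Nat.lt_succ_of_le (hsub hv).le
  refine ⟨(fun v => (sec v, α ^ m)) '' (vert '' A), ⟨(hfinite.image _).countable, ?_, ?_⟩, ?_, ?_⟩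
  · rintro _ ⟨v, hv, rfl⟩
    exact ⟨hsecA v hv, by positivity⟩
  · intro ω hω
    have hv : vert ω ∈ vert '' A := ⟨ω, hω, rfl⟩
    refine ⟨_, ⟨vert ω, hv, rfl⟩, SameComponent.endDist_le hα₀ hα₁ ⟨comp ω, ?_, hcomp ω⟩⟩
    have h1 := hvert (sec (vert ω))
    rw [hsec _ hv] at h1
    rw [← SimpleGraph.ComponentCompl.eq_of_mem_of_mem h1 (hvert ω)]
    exact hcomp _
  · rintro _ ⟨v, -, rfl⟩
    rfl
  · exact (Set.encard_image_le _ _).trans (Set.encard_le_encard hsub)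

/-- Each component outside the larger ball lies in one outside the smaller ball, which a vertex far
along a ray of `ω₁` identifies as `C`. -/
theorem SameComponent.containedIn {m n : ℕ} (hmn : m ≤ n) {ω₁ ω₂ : EndSpace X o} (h : SameComponent n ω₁ ω₂)
    {C : X.ComponentCompl (ballBelow X o m)} (hC : ω₁.ContainedIn (C : Set V)) :
    ω₂.ContainedIn (C : Set V) := by
  obtain ⟨D, hD₁, hD₂⟩ := h
  obtain ⟨r, hr⟩ := Quot.exists_rep ω₁
  obtain ⟨k, hk1, hk2⟩ := ((hC r hr).and (hD₁ r hr)).exists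
  have hsub := D.subset_hom (ballBelow_mono hmn)
  have heq : D.hom (ballBelow_mono hmn) = C :=
    SimpleGraph.ComponentCompl.eq_of_mem_of_mem (hsub hk2) hk1
  rw [heq] at hsub
  exact fun s hs => (hD₂ s hs).mono fun n hn => hsub hn

/-- A sequence of vertices with additive distances lies on a ray. -/
theorem exists_rootedRay_of_geodesic (hX : X.Connected) {v : ℕ → V}
    (hv : ∀ j k, j ≤ k → X.dist (v j) (v k) + X.dist o (v j) = X.dist o (v k))
    (hmono : StrictMono fun k => X.dist o (v k)) :
    ∃ r : RootedRay X o, ∀ k, r.vertex (X.dist o (v k)) = v k := by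
  -- `u` is at distance `n` from `o` and on a geodesic from `o` to each `v k` still ahead. A step
  -- towards the nearest of these preserves the property for all later ones.
  let P : ℕ → V → Prop := fun n u =>
    X.dist o u = n ∧ ∀ k, n ≤ X.dist o (v k) → X.dist u (v k) + n = X.dist o (v k)
  have hstep : ∀ n u, P n u → ∃ u', X.Adj u u' ∧ P (n + 1) u' := by
    intro n u hu
    classical
    have hex : ∃ k, n + 1 ≤ X.dist o (v k) := ⟨n + 1, hmono.le_apply (x := n + 1)⟩
    set k := Nat.find hex with hk
    have hkspec : n + 1 ≤ X.dist o (v k) := Nat.find_spec hex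
    have hd := hu.2 k (by omega)
    obtain ⟨u', hadj, hu'⟩ := exists_adj_dist_add_one_eq hX
      (u := u) (v := v k) (n := X.dist o (v k) - (n + 1)) (by omega)
    have h1 := SimpleGraph.dist_eq_one_iff_adj.2 hadj
    have h2 := hX.dist_triangle (u := o) (v := u) (w := u')
    have h3 := hX.dist_triangle (u := o) (v := u') (w := v k)
    have h4 := hu.1
    refine ⟨u', hadj, by omega, fun j hj => ?_⟩
    have hkj : k ≤ j := Nat.find_min' hex hj
    have h5 := hX.dist_triangle (u := u') (v := v k) (w := v j)
    have h6 := hv k j hkj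
    have h7 := hX.dist_triangle (u := o) (v := u') (w := v j)
    omega
  have h0 : P 0 o := ⟨SimpleGraph.dist_self, fun k _ => rfl⟩
  choose next hadj hnext using hstep
  let f : (n : ℕ) → {u // P n u} := fun n =>
    Nat.rec ⟨o, h0⟩ (fun n u => ⟨next n u.1 u.2, hnext n u.1 u.2⟩) n
  refine ⟨⟨fun n => (f n).1, rfl, fun n => hadj n _ (f n).2, fun m n hmn => ?_⟩, fun k => ?_⟩
  · have h1 := (f m).2.1
    have h2 := (f n).2.1
    have h3 : (f m).1 = (f n).1 := hmn
    rw [h3] at h1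
    omega
  · have := (f (X.dist o (v k))).2.2 k le_rfl
    exact hX.dist_eq_zero_iff.1 (Nat.add_eq_right.1 this)

end EndsOfGraph

/-! ### Counting elements of a free product by length -/

section Counting

open Monoid

variable {ι : Type*} {G : ι → Type*} [∀ i, Group (G i)] {S : ∀ i, Set (G i)}

/-- The ball of radius `n` in a factor without its centre, and its generating polynomial. -/
theorem exists_finset_sum_pow_length [Finite ι] (hfinite : ∀ i, (S i).Finite)
    (hsymm : ∀ i, ∀ s ∈ S i, s⁻¹ ∈ S i) (hgen : ∀ i, Subgroup.closure (S i) = ⊤) (i : ι) (n : ℕ) :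
    ∃ B : Finset (G i), (∀ g, g ∈ B ↔ g ≠ 1 ∧ freeProductLength S (CoprodI.of g) ≤ n) ∧
      ∀ z : ℝ, ∑ g ∈ B, z ^ freeProductLength S (CoprodI.of g) =
        ∑ m ∈ Finset.range n, (sphereCount S i (m + 1) : ℝ) * z ^ (m + 1) := by
  classical
  have hl : ∀ g : G i, freeProductLength S (CoprodI.of g) = 0 ↔ g = 1 := fun g => by
    rw [freeProductLength_eq_zero hgen, map_eq_one_iff _ (CoprodI.of_injective i)]
  set B := (finite_length_factor_le hfinite hsymm hgen i n).toFinset.filter (· ≠ 1) with hB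
  have hmem : ∀ g, g ∈ B ↔ g ≠ 1 ∧ freeProductLength S (CoprodI.of g) ≤ n := fun g => by
    simp [hB, and_comm]
  refine ⟨B, hmem, fun z => ?_⟩
  rw [← Finset.sum_fiberwise_of_maps_to (s := B) (t := Finset.range n)
    (g := fun g => freeProductLength S (CoprodI.of g) - 1)]
  · refine Finset.sum_congr rfl fun m hm => ?_
    have hcount : sphereCount S i (m + 1) =
        (B.filter fun g => freeProductLength S (CoprodI.of g) - 1 = m).card := by
      rw [sphereCount, ← Set.ncard_coe_finset]
      congr 1
      ext g
      have := hl g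
      have hm := Finset.mem_range.1 hm
      simp only [Finset.coe_filter, hmem, Set.mem_ofPred_eq, ne_eq]
      rw [← this]
      omega
    rw [hcount, ← nsmul_eq_mul, ← Finset.sum_const]
    refine Finset.sum_congr rfl fun g hg => ?_
    obtain ⟨hgB, hgm⟩ := Finset.mem_filter.1 hg
    have : freeProductLength S (CoprodI.of g) ≠ 0 := fun h => ((hmem g).1 hgB).1 ((hl g).1 h)
    rw [show freeProductLength S (CoprodI.of g) = m + 1 by omega]
  · intro g hg
    have h1 := (hmem g).1 hg
    have : freeProductLength S (CoprodI.of g) ≠ 0 := fun h => h1.1 ((hl g).1 h)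
    rw [Finset.mem_range]
    omega

open Classical in
theorem tsum_pow_length_le [Finite ι] (hfinite : ∀ i, (S i).Finite)
    (hsymm : ∀ i, ∀ s ∈ S i, s⁻¹ ∈ S i) (hgen : ∀ i, Subgroup.closure (S i) = ⊤) (i : ι)
    {z : ℝ} (hz : 0 ≤ z) (hs : Summable fun m => (sphereCount S i (m + 1) : ℝ) * z ^ (m + 1)) :
    ∑' g : G i, (if g = 1 then 0 else ENNReal.ofReal (z ^ freeProductLength S (CoprodI.of g))) ≤
      ENNReal.ofReal (∑' m, (sphereCount S i (m + 1) : ℝ) * z ^ (m + 1)) := by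
  rw [ENNReal.tsum_eq_iSup_sum]
  refine iSup_le fun s => ?_
  obtain ⟨B, hB, hsum⟩ := exists_finset_sum_pow_length hfinite hsymm hgen i
    (s.sup fun g => freeProductLength S (CoprodI.of g))
  calc ∑ g ∈ s, (if g = 1 then 0 else ENNReal.ofReal (z ^ freeProductLength S (CoprodI.of g)))
      ≤ ∑ g ∈ B, ENNReal.ofReal (z ^ freeProductLength S (CoprodI.of g)) := by
        simp_rw [← ite_not (p := _ = _)]
        rw [← Finset.sum_filter]
        refine Finset.sum_le_sum_of_subset fun g hg => ?_
        obtain ⟨h1, h2⟩ := Finset.mem_filter.1 hg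
        exact (hB g).2 ⟨h2, Finset.le_sup (f := fun g => freeProductLength S (CoprodI.of g)) h1⟩
    _ ≤ _ := by
        rw [← ENNReal.ofReal_sum_of_nonneg fun g _ => by positivity, hsum]
        exact ENNReal.ofReal_le_ofReal (hs.sum_le_tsum _ fun m _ => by positivity)

/-- Lists are empty or have a head and a tail. -/
def listEquivSum (α : Type*) : Unit ⊕ (α × List α) ≃ List α where
  toFun o := o.elim (fun _ => []) fun p => p.1 :: p.2
  invFun L := match L with
    | [] => Sum.inl ()
    | a :: t => Sum.inr (a, t)
  left_inv o := by cases o <;> rfl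
  right_inv L := by cases L <;> rfl

theorem tsum_list {α : Type*} (f : List α → ℝ≥0∞) :
    ∑' L, f L = f [] + ∑' a, ∑' t, f (a :: t) := by
  rw [← (listEquivSum α).tsum_eq, ENNReal.summable.tsum_sum ENNReal.summable, tsum_fintype,
    ENNReal.tsum_prod']
  simp [listEquivSum]

open Classical in
/-- The weight `z ^ l(L)` of a word `L` of at most `n` letters, provided that its letters are
nontrivial, consecutive letters lie in different factors and the first one does not lie in the
factor `j`. -/
noncomputable def wordWeight (S : ∀ i, Set (G i)) (z : ℝ) :
    ℕ → Option ι → List (Σ i, G i) → ℝ≥0∞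
  | _, _, [] => 1
  | 0, _, _ :: _ => 0
  | n + 1, j, a :: t => if some a.1 = j ∨ a.2 = 1 then 0 else
      ENNReal.ofReal (z ^ freeProductLength S (CoprodI.of a.2)) * wordWeight S z n (some a.1) t

theorem wordWeight_of_isReducedWord {z : ℝ} (hz : 0 ≤ z) {L : List (Σ i, G i)}
    (hL : IsReducedWord L) {n : ℕ} (hn : L.length ≤ n) {j : Option ι}
    (hj : ∀ a ∈ L.head?, some a.1 ≠ j) :
    wordWeight S z n j L = ENNReal.ofReal (z ^ listLength S L) := by
  induction L generalizing n j with
  | nil => cases n <;> simp [wordWeight]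
  | cons a t ih =>
    obtain ⟨n, rfl⟩ : ∃ k, n = k + 1 := ⟨n - 1, by rw [List.length_cons] at hn; omega⟩
    have hne : ¬ (some a.1 = j ∨ a.2 = 1) := by
      rintro (h | h)
      · exact hj a (by simp) h
      · exact hL.1 a (by simp) h
    have hchain := List.isChain_cons.1 hL.2
    rw [wordWeight, if_neg hne, ih ⟨fun b hb => hL.1 b (List.mem_cons_of_mem _ hb), hchain.2⟩
      (by simpa using hn) (fun b hb h => hchain.1 b hb (by simpa using h.symm)),
      ← ENNReal.ofReal_mul (by positivity), ← pow_add, listLength_cons]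

theorem length_le_listLength (hgen : ∀ i, Subgroup.closure (S i) = ⊤) {L : List (Σ i, G i)}
    (hL : ∀ a ∈ L, a.2 ≠ 1) : L.length ≤ listLength S L := by
  induction L with
  | nil => simp
  | cons a t ih =>
    have h1 := ih fun b hb => hL b (List.mem_cons_of_mem _ hb)
    have h2 : freeProductLength S (CoprodI.of a.2) ≠ 0 := fun h => by
      rw [freeProductLength_eq_zero hgen, map_eq_one_iff _ (CoprodI.of_injective a.1)] at h
      exact hL a (by simp) h
    rw [List.length_cons, listLength_cons]
    omega

variable [Fintype ι]

/-- Splitting off the first letter gives `F j = 1 + ∑_{i ≠ j} E i * F i` for the generating function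
of words not starting in the factor `j`. The right-hand side `K / (1 + E j)` of the bound is a
supersolution by `hP`, so it dominates by induction on the number of letters, without presupposing
convergence. -/
theorem tsum_wordWeight_le (hfinite : ∀ i, (S i).Finite)
    (hsymm : ∀ i, ∀ s ∈ S i, s⁻¹ ∈ S i) (hgen : ∀ i, Subgroup.closure (S i) = ⊤)
    {z : ℝ} (hz : 0 ≤ z) {E : ι → ℝ} (hE : ∀ i, 0 ≤ E i)
    (hsum : ∀ i, E i = ∑' m, (sphereCount S i (m + 1) : ℝ) * z ^ (m + 1))
    (hs : ∀ i, Summable fun m => (sphereCount S i (m + 1) : ℝ) * z ^ (m + 1)) {K : ℝ} (hK : 0 ≤ K)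
    (hP : 1 + K * ∑ i, E i / (1 + E i) ≤ K) (n : ℕ) (j : Option ι) :
    ∑' L, wordWeight S z n j L ≤
      ENNReal.ofReal (K * (1 - j.elim 0 fun i => E i / (1 + E i))) := by
  classical
  have hp : ∀ i, 1 - E i / (1 + E i) = 1 / (1 + E i) := fun i => by
    have := hE i
    field_simp
    ring
  have hbound : ∀ j : Option ι, 1 + ∑ i, (if some i = j then 0 else K * (E i / (1 + E i))) ≤
      K * (1 - j.elim 0 fun i => E i / (1 + E i)) := by
    intro j
    have h1 : ∑ i, (if some i = j then 0 else K * (E i / (1 + E i))) =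
        K * ∑ i, E i / (1 + E i) - K * (j.elim 0 fun i => E i / (1 + E i)) := by
      rw [eq_sub_iff_add_eq, Finset.mul_sum]
      cases j with
      | none => simp
      | some j =>
        rw [← Finset.sum_erase_add _ _ (Finset.mem_univ j),
          ← Finset.sum_erase_add _ (fun i => K * (E i / (1 + E i))) (Finset.mem_univ j)]
        simp only [if_true, add_zero, Option.elim_some]
        congr 1
        refine Finset.sum_congr rfl fun i hi => if_neg ?_
        simpa using Finset.ne_of_mem_erase hi
    rw [h1]
    linarith
  have hnonneg : ∀ (j : Option ι) (i : ι),
      0 ≤ if some i = j then 0 else K * (E i / (1 + E i)) := fun j i => by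
    have := hE i
    split_ifs <;> positivity
  induction n generalizing j with
  | zero =>
    rw [tsum_list]
    simp only [wordWeight, tsum_zero, add_zero]
    rw [← ENNReal.ofReal_one]
    refine ENNReal.ofReal_le_ofReal (le_trans ?_ (hbound j))
    linarith [Finset.sum_nonneg fun i (_ : i ∈ Finset.univ) => hnonneg j i]
  | succ n ih =>
    rw [tsum_list, ENNReal.tsum_sigma', tsum_fintype]
    have hterm : ∀ i, ∑' g : G i, ∑' t, wordWeight S z (n + 1) j (⟨i, g⟩ :: t) ≤
        ENNReal.ofReal (if some i = j then 0 else K * (E i / (1 + E i))) := by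
      intro i
      by_cases hij : some i = j
      · simp [wordWeight, hij]
      · have hrw : ∀ g : G i, ∑' t, wordWeight S z (n + 1) j (⟨i, g⟩ :: t) =
            (if g = 1 then 0 else ENNReal.ofReal (z ^ freeProductLength S (CoprodI.of g))) *
              ∑' t, wordWeight S z n (some i) t := by
          intro g
          rw [← ENNReal.tsum_mul_left]
          refine tsum_congr fun t => ?_
          by_cases hg : g = 1 <;> simp [wordWeight, hij, hg]
        simp_rw [hrw]
        rw [ENNReal.tsum_mul_right, if_neg hij]
        refine (mul_le_mul' (tsum_pow_length_le hfinite hsymm hgen i hz (hs i)) (ih (some i))).trans ?_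
        rw [← hsum, ← ENNReal.ofReal_mul (hE i), Option.elim_some, hp]
        refine ENNReal.ofReal_le_ofReal (le_of_eq ?_)
        ring
    calc wordWeight S z (n + 1) j [] + ∑ i, ∑' g : G i, ∑' t, wordWeight S z (n + 1) j (⟨i, g⟩ :: t)
        ≤ ENNReal.ofReal 1 + ∑ i, ENNReal.ofReal (if some i = j then 0 else K * (E i / (1 + E i))) := by
          rw [ENNReal.ofReal_one]
          exact add_le_add (by simp [wordWeight]) (Finset.sum_le_sum fun i _ => hterm i)
      _ = ENNReal.ofReal (1 + ∑ i, if some i = j then 0 else K * (E i / (1 + E i))) := by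
          rw [← ENNReal.ofReal_sum_of_nonneg fun i _ => hnonneg j i,
            ← ENNReal.ofReal_add zero_le_one (Finset.sum_nonneg fun i _ => hnonneg j i)]
      _ ≤ _ := ENNReal.ofReal_le_ofReal (hbound j)

/-- To the left of the root, the spheres of the free product satisfy an exponential bound. -/
theorem exists_encard_sphere_le (hfinite : ∀ i, (S i).Finite)
    (hsymm : ∀ i, ∀ s ∈ S i, s⁻¹ ∈ S i) (hgen : ∀ i, Subgroup.closure (S i) = ⊤)
    {z : ℝ} (hz : 0 < z)
    (hs : ∀ i, Summable fun m => (sphereCount S i (m + 1) : ℝ) * z ^ (m + 1))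
    (hlt : ratioSum (fun i m => (sphereCount S i (m + 1) : ℝ)) z < 1) :
    ∃ K : ℝ, 0 < K ∧ ∀ m : ℕ, ({x | freeProductLength S x = m}.encard : ℝ≥0∞) ≤
      ENNReal.ofReal (K * (z ^ m)⁻¹) := by
  set P := ratioSum (fun i m => (sphereCount S i (m + 1) : ℝ)) z with hPdef
  -- `1 / (1 - P)` is the solution `K` of `1 + K * P = K`.
  have hKpos : 0 < 1 / (1 - P) := by
    have : 0 < 1 - P := by linarith
    positivity
  refine ⟨1 / (1 - P), hKpos, fun m => ?_⟩
  have hbound := tsum_wordWeight_le hfinite hsymm hgen hz.le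
    (E := fun i => ∑' m, (sphereCount S i (m + 1) : ℝ) * z ^ (m + 1))
    (fun i => tsum_nonneg fun m => by positivity) (fun i => rfl) hs hKpos.le (by
      change 1 + 1 / (1 - P) * P ≤ 1 / (1 - P)
      have : 1 - P ≠ 0 := by linarith
      refine le_of_eq ?_
      field_simp
      ring) m none
  have hle : ({x | freeProductLength S x = m}.encard : ℝ≥0∞) * ENNReal.ofReal (z ^ m) ≤
      ENNReal.ofReal (1 / (1 - P)) := by
    calc ({x | freeProductLength S x = m}.encard : ℝ≥0∞) * ENNReal.ofReal (z ^ m)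
        = ∑' _ : {x | freeProductLength S x = m}, ENNReal.ofReal (z ^ m) := by
          rw [ENNReal.tsum_const]; rfl
      _ = ∑' x : {x | freeProductLength S x = m}, wordWeight S z m none (reducedWord x.1) := by
          refine tsum_congr fun x => ?_
          have hx : freeProductLength S x.1 = m := x.2
          have hlen := listLength_reducedWord hsymm hgen x.1
          have hred := isReduced_reducedWord x.1
          -- Nontrivial letters have length at least `1`, so elements of length `m` have at most `m`
          -- letters and the cut-off loses none of them.
          rw [wordWeight_of_isReducedWord hz.le hred
            ((length_le_listLength hgen hred.1).trans (by omega)) (by simp), hlen, hx]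
      _ ≤ ∑' L, wordWeight S z m none L :=
          ENNReal.tsum_comp_le_tsum_of_injective
            (reducedWord_injective.comp Subtype.val_injective) _
      _ ≤ _ := by simpa using hbound
  have hzm : ENNReal.ofReal (z ^ m) ≠ 0 := by simp; positivity
  rw [← div_eq_mul_inv, ENNReal.ofReal_div_of_pos (by positivity),
    ENNReal.le_div_iff_mul_le (Or.inl hzm) (Or.inl ENNReal.ofReal_ne_top)]
  exact hle

end Counting

/-! ### Families of prefixes met by all infinite words -/

section PrefixFamilies

open Monoid

variable {ι : Type*} {G : ι → Type*}

/-- The first `n` letters of an infinite word. -/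
def firstLetters (x : ℕ → Σ i, G i) (n : ℕ) : List (Σ i, G i) :=
  (List.range n).map x

theorem firstLetters_succ (x : ℕ → Σ i, G i) (n : ℕ) :
    firstLetters x (n + 1) = firstLetters x n ++ [x n] := by
  simp [firstLetters, List.range_succ]

@[simp]
theorem length_firstLetters (x : ℕ → Σ i, G i) (n : ℕ) : (firstLetters x n).length = n := by
  simp [firstLetters]

theorem firstLetters_prefix (x : ℕ → Σ i, G i) {m n : ℕ} (h : m ≤ n) :
    firstLetters x m <+: firstLetters x n := by
  induction n, h using Nat.le_induction with
  | base => exact List.prefix_rfl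
  | succ n _ ih =>
    rw [firstLetters_succ]
    exact ih.trans (List.prefix_append _ _)

variable [∀ i, Group (G i)] {S : ∀ i, Set (G i)}

theorem wordPrefix_eq_listProd (x : ℕ → Σ i, G i) (n : ℕ) :
    wordPrefix x n = listProd (firstLetters x n) := by
  simp [wordPrefix, listProd, firstLetters, Function.comp_def]

theorem IsInfiniteWord.isReducedWord {x : ℕ → Σ i, G i} (hx : IsInfiniteWord x) (n : ℕ) :
    IsReducedWord (firstLetters x n) := by
  refine ⟨fun a ha => ?_, ?_⟩
  · obtain ⟨k, -, rfl⟩ := List.mem_map.1 ha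
    exact (hx k).1
  · rw [List.isChain_iff_getElem]
    intro k hk
    simpa [firstLetters] using (hx k).2

theorem listLength_firstLetters_succ (x : ℕ → Σ i, G i) (n : ℕ) :
    listLength S (firstLetters x (n + 1)) =
      listLength S (firstLetters x n) + freeProductLength S (CoprodI.of (x n).2) := by
  simp [firstLetters_succ]

/-- At most one letter continues `v` to a longer prefix of `w`. -/
theorem sum_prefix_append_le {α : Type*} [DecidableEq α] (v w : List α) (A : Finset α) (c : ℝ≥0∞) :
    ∑ a ∈ A, (if v ++ [a] <+: w then c else 0) ≤ if v <+: w then c else 0 := by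
  by_cases h : ∃ a, v ++ [a] <+: w
  · obtain ⟨a, ha⟩ := h
    have hiff : ∀ b, v ++ [b] <+: w ↔ b = a := by
      refine fun b => ⟨fun hb => ?_, fun hb => hb ▸ ha⟩
      obtain ⟨s, hs⟩ := ha
      obtain ⟨t, ht⟩ := hb
      rw [← ht] at hs
      simp only [List.append_assoc, List.append_cancel_left_eq, List.singleton_append,
        List.cons.injEq] at hs
      exact hs.1.symm
    rw [if_pos ((List.prefix_append v [a]).trans ha)]
    simp only [hiff, Finset.sum_ite_eq']
    split_ifs <;> simp
  · push Not at h
    simp [h]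

variable [Fintype ι]

/-- If every infinite word over the finite alphabets `B i` has a prefix in a family of words, then
the weights `z ^ l(w)` of the family add up to at least `1`, provided that the generating
polynomials `E i` of the alphabets satisfy `1 ≤ ∑ E i / (1 + E i)`. -/
theorem one_le_tsum_pow_listLength {B : ∀ i, Finset (G i)} (hB : ∀ i, ∀ g ∈ B i, g ≠ 1) {z : ℝ}
    (hz : 0 < z) {E : ι → ℝ}
    (hE : ∀ i, E i = ∑ g ∈ B i, z ^ freeProductLength S (CoprodI.of g))
    (hsum : 1 ≤ ∑ i, E i / (1 + E i)) {J : Type*} (w : J → List (Σ i, G i))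
    (hw : ∀ x : ℕ → Σ i, G i, IsInfiniteWord x → (∀ n, (x n).2 ∈ B (x n).1) →
      ∃ p n, w p = firstLetters x n) :
    1 ≤ ∑' p, ENNReal.ofReal (z ^ listLength S (w p)) := by
  classical
  have hE0 : ∀ i, 0 ≤ E i := fun i => by
    rw [hE]
    positivity
  have hp : ∀ i, 1 - E i / (1 + E i) = 1 / (1 + E i) := fun i => by
    have := hE0 i
    field_simp
    ring
  -- The correction for the last letter accounts for its factor `j` being barred next: `∑_{i ≠ j} E
  -- i / (1 + E i) ≥ 1 / (1 + E j)`. With it, the mass `ν v` is at most the total mass of the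
  -- one-letter extensions of `v`.
  let h : List (Σ i, G i) → ℝ := fun v => v.getLast?.elim 1 fun a => 1 / (1 + E a.1)
  have hh0 : ∀ v, 0 ≤ h v := fun v => by
    simp only [h]
    cases v.getLast? with
    | none => simp
    | some a => have := hE0 a.1; simp only [Option.elim_some]; positivity
  have hh1 : ∀ v, h v ≤ 1 := fun v => by
    simp only [h]
    cases v.getLast? with
    | none => simp
    | some a =>
      have := hE0 a.1
      simp only [Option.elim_some]
      rw [div_le_one (by positivity)]
      linarith
  let ν : List (Σ i, G i) → ℝ := fun v => z ^ listLength S v * h v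
  have hν0 : ∀ v, 0 ≤ ν v := fun v => mul_nonneg (by positivity) (hh0 v)
  have hν1 : ∀ v, ν v ≤ z ^ listLength S v := fun v =>
    mul_le_of_le_one_right (by positivity) (hh1 v)
  refine le_trans ?_ (ENNReal.tsum_le_tsum fun p => ENNReal.ofReal_le_ofReal (hν1 (w p)))
  by_contra! hlt
  -- `Φ v` is the mass of the family members extending `v`. It is at least the total over the
  -- one-letter extensions, so a deficit `Φ v < ν v` passes to some extension. Following it from the
  -- empty word builds an infinite word; a family member among its prefixes would have no deficit,
  -- as it counts itself.
  let Φ : List (Σ i, G i) → ℝ≥0∞ := fun v =>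
    ∑' p, if v <+: w p then ENNReal.ofReal (ν (w p)) else 0
  let next : List (Σ i, G i) → Finset (Σ i, G i) := fun v =>
    (Finset.univ.sigma B).filter fun a => ∀ b ∈ v.getLast?, b.1 ≠ a.1
  have hνnext : ∀ v, ν v ≤ ∑ a ∈ next v, ν (v ++ [a]) := by
    intro v
    have hterm : ∀ i, ∑ g ∈ B i, (if ∀ b ∈ v.getLast?, b.1 ≠ i then
        ν (v ++ [(⟨i, g⟩ : Σ i, G i)]) else 0) = z ^ listLength S v *
          (if ∀ b ∈ v.getLast?, b.1 ≠ i then E i / (1 + E i) else 0) := by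
      intro i
      split_ifs with hi
      · simp only [ν, h, listLength_append, listLength_cons, listLength_nil, add_zero, pow_add,
          List.getLast?_append, List.getLast?_singleton, Option.some_or, Option.elim_some]
        rw [hE i, Finset.sum_div, Finset.mul_sum]
        refine Finset.sum_congr rfl fun g _ => ?_
        ring
      · simp
    simp only [next]
    rw [Finset.sum_filter, Finset.sum_sigma]
    simp only [hterm]
    rw [← Finset.mul_sum]
    refine mul_le_mul_of_nonneg_left ?_ (by positivity)
    simp only [h]
    cases hv : v.getLast? with
    | none => simpa using hsum
    | some a =>
      simp only [Option.elim_some, Option.mem_def, Option.some.injEq, forall_eq']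
      rw [← hp, ← Finset.sum_filter, Finset.filter_ne, Finset.sum_erase_eq_sub (Finset.mem_univ _)]
      linarith
  have hΦnext : ∀ v, ∑ a ∈ next v, Φ (v ++ [a]) ≤ Φ v := by
    intro v
    simp only [Φ]
    rw [← Summable.tsum_finsetSum fun _ _ => ENNReal.summable]
    exact ENNReal.tsum_le_tsum fun p => sum_prefix_append_le _ _ _ _
  have hΦw : ∀ p, ENNReal.ofReal (ν (w p)) ≤ Φ (w p) := fun p => by
    refine le_trans (le_of_eq ?_) (ENNReal.le_tsum p)
    rw [if_pos List.prefix_rfl]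
  have hstep : ∀ v, Φ v < ENNReal.ofReal (ν v) →
      ∃ a ∈ next v, Φ (v ++ [a]) < ENNReal.ofReal (ν (v ++ [a])) := by
    intro v hv
    by_contra! hcon
    refine hv.not_ge (le_trans ?_ (hΦnext v))
    refine (ENNReal.ofReal_le_ofReal (hνnext v)).trans ?_
    rw [ENNReal.ofReal_sum_of_nonneg fun a _ => hν0 _]
    exact Finset.sum_le_sum hcon
  choose a ha hgood using hstep
  have h0 : Φ [] < ENNReal.ofReal (ν []) := by
    simpa [Φ, ν, h] using hlt
  let f : ℕ → {v // Φ v < ENNReal.ofReal (ν v)} := fun n =>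
    Nat.rec ⟨[], h0⟩ (fun _ v => ⟨v.1 ++ [a v.1 v.2], hgood v.1 v.2⟩) n
  let x : ℕ → Σ i, G i := fun n => a (f n).1 (f n).2
  have hf : ∀ n, (f n).1 = firstLetters x n := by
    intro n
    induction n with
    | zero => rfl
    | succ n ih =>
      rw [firstLetters_succ, ← ih]
  have hx : ∀ n, x n ∈ next (f n).1 := fun n => ha _ _
  have hxB : ∀ n, (x n).2 ∈ B (x n).1 := fun n =>
    (Finset.mem_sigma.1 (Finset.mem_filter.1 (hx n)).1).2
  obtain ⟨p, n, hpn⟩ := hw x (fun n => ⟨hB _ _ (hxB n), by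
    have hlast : (f (n + 1)).1.getLast? = some (x n) :=
      (congrArg List.getLast? ((hf (n + 1)).trans (firstLetters_succ x n))).trans (by simp)
    exact (Finset.mem_filter.1 (hx (n + 1))).2 (x n) hlast⟩) hxB
  have h1 := (f n).2
  rw [hf, ← hpn] at h1
  exact h1.not_ge (hΦw p)

end PrefixFamilies

/-! ### Balls in the space of ends of a free product -/

section BallsOfEnds

open Monoid

variable {ι : Type*} {G : ι → Type*} [∀ i, Group (G i)] {S : ∀ i, Set (G i)}

/-- A component of the complement of a ball stays within the words starting with any given word
in the ball. -/
theorem prefix_of_mem_componentCompl (hsymm : ∀ i, ∀ s ∈ S i, s⁻¹ ∈ S i)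
    {m : ℕ} {C : (freeProductGraph S).ComponentCompl (ballBelow (freeProductGraph S) 1 m)}
    {w : List (Σ i, G i)} (hw : freeProductLength S (listProd w) < m) {u v : CoprodI G}
    (hu : u ∈ C) (hv : v ∈ C) (hwu : w <+: reducedWord u) : w <+: reducedWord v := by
  obtain ⟨hu', rfl⟩ := hu
  obtain ⟨hv', h⟩ := hv
  obtain ⟨p⟩ := SimpleGraph.ConnectedComponent.eq.1 h.symm
  have key : ∀ a b : ((ballBelow (freeProductGraph S) 1 m)ᶜ : Set (CoprodI G)),
      ((freeProductGraph S).induce _).Walk a b → w <+: reducedWord a.1 → w <+: reducedWord b.1 := by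
    intro a b p
    induction p with
    | nil => exact id
    | @cons a b c hadj q ih =>
      -- An edge leaves the words starting with `w` only at `w` itself, which lies in the removed
      -- ball.
      refine fun ha => ih (by_contra fun hb => ?_)
      have hadj' : (freeProductGraph S).Adj a.1 b.1 := hadj
      obtain ⟨-, i, s, hs, hbs⟩ := (freeProductGraph_adj_iff hsymm).1 hadj'
      rw [hbs] at hb
      have := eq_of_prefix_of_not_prefix ha hb
      rw [this, listProd_reducedWord] at hw
      exact a.2 hw
  exact key _ _ p hwu

/-- An infinite word describes an end, by a ray through all of its prefixes. -/
theorem IsInfiniteWord.exists_rootedRay (hsymm : ∀ i, ∀ s ∈ S i, s⁻¹ ∈ S i)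
    (hgen : ∀ i, Subgroup.closure (S i) = ⊤) {x : ℕ → Σ i, G i} (hx : IsInfiniteWord x) :
    ∃ r : RootedRay (freeProductGraph S) 1, ∃ d : ℕ → ℕ, StrictMono d ∧
      ∀ n, r.vertex (d n) = listProd (firstLetters x n) := by
  have hlen : ∀ n, (freeProductGraph S).dist 1 (listProd (firstLetters x n)) =
      listLength S (firstLetters x n) := fun n =>
    freeProductLength_listProd hsymm hgen (hx.isReducedWord n)
  have hmono : StrictMono fun n =>
      (freeProductGraph S).dist 1 (listProd (firstLetters x n)) := by
    refine strictMono_nat_of_lt_succ fun n => ?_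
    rw [hlen, hlen, listLength_firstLetters_succ]
    have : freeProductLength S (CoprodI.of (x n).2) ≠ 0 := fun h => (hx n).1 <| by
      rwa [freeProductLength_eq_zero hgen, map_eq_one_iff _ (CoprodI.of_injective _)] at h
    omega
  have hgeo : ∀ j k, j ≤ k →
      (freeProductGraph S).dist (listProd (firstLetters x j)) (listProd (firstLetters x k)) +
        (freeProductGraph S).dist 1 (listProd (firstLetters x j)) =
        (freeProductGraph S).dist 1 (listProd (firstLetters x k)) := by
    intro j k hjk
    obtain ⟨t, ht⟩ := firstLetters_prefix x hjk
    have h1 : listLength S (firstLetters x j) + listLength S t =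
        listLength S (firstLetters x k) := by rw [← ht, listLength_append]
    have h2 : (freeProductGraph S).dist (listProd (firstLetters x j)) (listProd (firstLetters x k))
        ≤ listLength S t := by
      rw [← freeProductLength_inv_mul hgen, ← ht, listProd_append, inv_mul_cancel_left]
      exact freeProductLength_listProd_le hgen t
    have h3 := (freeProductGraph_connected hgen).dist_triangle (u := 1)
      (v := listProd (firstLetters x j)) (w := listProd (firstLetters x k))
    rw [hlen, hlen] at h3 ⊢
    omega
  obtain ⟨r, hr⟩ := exists_rootedRay_of_geodesic (freeProductGraph_connected hgen)
    (v := fun n => listProd (firstLetters x n)) hgeo hmono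
  exact ⟨r, _, hmono, hr⟩

theorem ballBelow_freeProductGraph_finite [Finite ι] (hfinite : ∀ i, (S i).Finite)
    (hsymm : ∀ i, ∀ s ∈ S i, s⁻¹ ∈ S i) (hgen : ∀ i, Subgroup.closure (S i) = ⊤) (m : ℕ) :
    (ballBelow (freeProductGraph S) 1 m).Finite :=
  (finite_freeProductLength_le hfinite hsymm hgen m).subset fun _ hx => le_of_lt (α := ℕ) hx

/-- Covers of the ends of infinite words by small balls cannot be too cheap. -/
theorem le_tsum_of_isBallCover [Fintype ι] (hfinite : ∀ i, (S i).Finite)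
    (hsymm : ∀ i, ∀ s ∈ S i, s⁻¹ ∈ S i) (hgen : ∀ i, Subgroup.closure (S i) = ⊤)
    {α : ℝ} (hα₀ : 0 < α) (hα₁ : α < 1) {δ : ℝ} (hδ : 0 < δ) {N : ℕ}
    (hN : 1 ≤ truncRatioSum (fun i m => (sphereCount S i (m + 1) : ℝ)) N (α ^ δ))
    {A : Set (FreeProductEnds S)} (hA : infiniteWordEnds S ⊆ A)
    {C : Set (FreeProductEnds S × ℝ)} (hC : IsBallCover (endDist α) A C) (hC1 : ∀ p ∈ C, p.2 < 1) :
    ENNReal.ofReal ((α ^ δ) ^ N) ≤ ∑' p : C, ENNReal.ofReal ((p : FreeProductEnds S × ℝ).2 ^ δ) := by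
  classical
  set z := α ^ δ with hz
  have hz0 : 0 < z := Real.rpow_pos_of_pos hα₀ _
  have hz1 : z < 1 := Real.rpow_lt_one hα₀.le hα₁ hδ
  have hconn := freeProductGraph_connected hgen
  have hball := ballBelow_freeProductGraph_finite hfinite hsymm hgen
  choose B hB hBsum using fun i => exists_finset_sum_pow_length hfinite hsymm hgen i N
  -- Radii below `1` are sorted by scale; the upper inequality is strict in order to yield
  -- confluence at least `m + 1`.
  have hlevel : ∀ p : C, ∃ m : ℕ, α ^ (m + 1) ≤ p.1.2 ∧ p.1.2 < α ^ m := by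
    intro p
    have hex : ∃ m : ℕ, α ^ m ≤ p.1.2 :=
      (exists_pow_lt_of_lt_one (hC.2.1 p.1 p.2).2 hα₁).imp fun _ h => h.le
    have hne : Nat.find hex ≠ 0 := fun h => by
      have := Nat.find_spec hex
      rw [h, pow_zero] at this
      exact (hC1 p.1 p.2).not_ge this
    obtain ⟨m, hm⟩ := Nat.exists_eq_succ_of_ne_zero hne
    refine ⟨m, by simpa only [hm] using Nat.find_spec hex, ?_⟩
    exact not_le.1 (Nat.find_min hex (by omega))
  choose m hm₁ hm₂ using hlevel
  let W : Type _ := {x : ℕ → Σ i, G i // IsInfiniteWord x ∧ ∀ n, (x n).2 ∈ B (x n).1}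
  choose ray d hd hray using fun x : W => x.2.1.exists_rootedRay hsymm hgen
  have hend : ∀ x : W, (ray x).toEnd ∈ A := fun x =>
    hA ⟨x.1, x.2.1, ray x, rfl, fun n => ⟨d x n, by rw [hray, wordPrefix_eq_listProd]⟩⟩
  -- The longest prefix of length at most `m p`. Its next letter has length at most `N`, so it falls
  -- short of level `m p + 1` by at most `N`.
  have hpre : ∀ p : C, ∀ x : W, ∃ k, listLength S (firstLetters x.1 k) ≤ m p ∧
      m p + 1 ≤ listLength S (firstLetters x.1 (k + 1)) := by
    intro p x
    have hex : ∃ k, m p + 1 ≤ listLength S (firstLetters x.1 k) :=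
      ⟨m p + 1, by
        simpa using length_le_listLength (S := S) hgen (x.2.1.isReducedWord (m p + 1)).1⟩
    have hne : Nat.find hex ≠ 0 := fun h => by
      have := Nat.find_spec hex
      rw [h] at this
      simp [firstLetters] at this
    obtain ⟨k, hk⟩ := Nat.exists_eq_succ_of_ne_zero hne
    refine ⟨k, ?_, by simpa only [hk] using Nat.find_spec hex⟩
    have := Nat.find_min hex (m := k) (by omega)
    omega
  choose k hk₁ hk₂ using hpre
  -- Balls containing no end of a word in `W` are dropped; each remaining one contributes the cut
  -- prefix of one chosen word.
  let J : Type _ := {p : C // ∃ x : W, endDist α p.1.1 (ray x).toEnd ≤ p.1.2}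
  choose x hx using fun p : J => p.2
  have hcomp : ∀ (p : C) (y : W), endDist α p.1.1 (ray y).toEnd ≤ p.1.2 →
      ∀ D : (freeProductGraph S).ComponentCompl (ballBelow (freeProductGraph S) 1 (m p + 1)),
      p.1.1.ContainedIn (D : Set (CoprodI G)) →
      ∀ᶠ n in atTop, listProd (firstLetters y.1 n) ∈ D := by
    intro p y hy D hD
    obtain ⟨n, hn, hsame⟩ := exists_sameComponent_of_le_confluence (Nat.succ_ne_zero (m p))
      (le_confluence_of_endDist_lt hα₀ hα₁ (hy.trans_lt (hm₂ p)))
    have := (hd y).tendsto_atTop.eventually (hsame.containedIn hn hD (ray y) rfl)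
    simp only [hray] at this
    exact this
  have hmain := one_le_tsum_pow_listLength (S := S) (B := B) (fun i g hg => ((hB i g).1 hg).1) hz0
    (E := fun i => ∑ m ∈ Finset.range N, (sphereCount S i (m + 1) : ℝ) * z ^ (m + 1))
    (fun i => (hBsum i z).symm) hN (fun p : J => firstLetters (x p).1 (k p.1 (x p))) (by
      intro y hy hyB
      let y' : W := ⟨y, hy, hyB⟩
      obtain ⟨p, hpC, hp⟩ := hC.2.2 _ (hend y')
      let q : J := ⟨⟨p, hpC⟩, y', hp⟩
      obtain ⟨D, hD, -⟩ := p.1.exists_containedIn hconn hball (m q.1 + 1)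
      have h1 := hcomp q.1 (x q) (hx q) D hD
      have h2 := hcomp q.1 y' hp D hD
      -- The chosen word and `y` have ends in the same ball, so their long prefixes enter the same
      -- component `D`. The cut prefix lies in the removed ball, hence it starts every element of
      -- `D` and is a prefix of `y`.
      set κ := k q.1 (x q) with hκ
      obtain ⟨n₁, hn₁, hk₁'⟩ := (h1.and (eventually_ge_atTop κ)).exists
      obtain ⟨n₂, hn₂, hk₂'⟩ := (h2.and (eventually_ge_atTop κ)).exists
      have hlt : freeProductLength S (listProd (firstLetters (x q).1 κ)) < m q.1 + 1 :=
        Nat.lt_succ_of_le ((freeProductLength_listProd_le hgen _).trans (hk₁ q.1 (x q)))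
      have hpref := prefix_of_mem_componentCompl hsymm hlt hn₁ hn₂ (by
        rw [reducedWord_listProd ((x q).2.1.isReducedWord n₁)]
        exact firstLetters_prefix _ hk₁')
      rw [reducedWord_listProd (y'.2.1.isReducedWord n₂)] at hpref
      refine ⟨q, κ, ?_⟩
      refine (List.prefix_of_prefix_length_le hpref (firstLetters_prefix y hk₂')
        (by simp)).eq_of_length (by simp [hκ]))
  have hterm : ∀ p : J, z ^ listLength S (firstLetters (x p).1 (k p.1 (x p))) * z ^ N ≤
      p.1.1.2 ^ δ := by
    intro p
    have h1 := hk₂ p.1 (x p)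
    rw [listLength_firstLetters_succ] at h1
    have h2 := ((hB _ _).1 ((x p).2.2 (k p.1 (x p)))).2
    rw [← pow_add]
    calc z ^ (listLength S (firstLetters (x p).1 (k p.1 (x p))) + N)
        ≤ z ^ (m p.1 + 1) := pow_le_pow_of_le_one hz0.le hz1.le (by omega)
      _ = (α ^ (m p.1 + 1)) ^ δ := by
          rw [hz, ← Real.rpow_natCast, ← Real.rpow_natCast, ← Real.rpow_mul hα₀.le,
            ← Real.rpow_mul hα₀.le, mul_comm]
      _ ≤ p.1.1.2 ^ δ := Real.rpow_le_rpow (by positivity) (hm₁ p.1) hδ.le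
  calc ENNReal.ofReal (z ^ N)
      ≤ (∑' p : J, ENNReal.ofReal (z ^ listLength S (firstLetters (x p).1 (k p.1 (x p))))) *
          ENNReal.ofReal (z ^ N) := le_mul_of_one_le_left bot_le hmain
    _ = ∑' p : J, ENNReal.ofReal
          (z ^ listLength S (firstLetters (x p).1 (k p.1 (x p))) * z ^ N) := by
        rw [← ENNReal.tsum_mul_right]
        exact tsum_congr fun p => (ENNReal.ofReal_mul (by positivity)).symm
    _ ≤ ∑' p : J, ENNReal.ofReal (p.1.1.2 ^ δ) :=
        ENNReal.tsum_le_tsum fun p => ENNReal.ofReal_le_ofReal (hterm p)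
    _ ≤ _ := ENNReal.tsum_comp_le_tsum_of_injective Subtype.val_injective
        fun p : C => ENNReal.ofReal (p.1.2 ^ δ)

end BallsOfEnds

/-! ### Dimensions of the space of ends of a free product -/

section Dimensions

open Monoid

variable {ι : Type*} [Fintype ι] {G : ι → Type*} [∀ i, Group (G i)] {S : ∀ i, Set (G i)}

theorem exists_sphereCount_pos (hfinite : ∀ i, (S i).Finite)
    (hsymm : ∀ i, ∀ s ∈ S i, s⁻¹ ∈ S i) (hgen : ∀ i, Subgroup.closure (S i) = ⊤) (i : ι)
    [Nontrivial (G i)] : ∃ m, 0 < (sphereCount S i (m + 1) : ℝ) := by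
  obtain ⟨g, hg⟩ := exists_ne (1 : G i)
  have hl : freeProductLength S (CoprodI.of g) ≠ 0 := fun h => by
    rw [freeProductLength_eq_zero hgen, map_eq_one_iff _ (CoprodI.of_injective i)] at h
    exact hg h
  obtain ⟨m, hm⟩ := Nat.exists_eq_succ_of_ne_zero hl
  refine ⟨m, Nat.cast_pos.2 ((Set.ncard_pos ?_).2 ⟨g, hm⟩)⟩
  exact (finite_length_factor_le hfinite hsymm hgen i (m + 1)).subset fun x hx => le_of_eq hx

theorem card_le_sum_sphereCount (hfinite : ∀ i, (S i).Finite)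
    (hsymm : ∀ i, ∀ s ∈ S i, s⁻¹ ∈ S i) (hgen : ∀ i, Subgroup.closure (S i) = ⊤) (i : ι)
    {T : Finset (G i)} (hT : 1 ∉ T) {n : ℕ}
    (hn : ∀ g ∈ T, freeProductLength S (CoprodI.of g) ≤ n) :
    (T.card : ℝ) ≤ ∑ m ∈ Finset.range n, (sphereCount S i (m + 1) : ℝ) * 1 ^ (m + 1) := by
  obtain ⟨B, hB, hsum⟩ := exists_finset_sum_pow_length hfinite hsymm hgen i n
  rw [← hsum 1]
  simp only [one_pow, Finset.sum_const, nsmul_eq_mul, mul_one]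
  exact_mod_cast Finset.card_le_card fun g hg =>
    (hB g).2 ⟨fun h => hT (h ▸ hg), hn g hg⟩

/-- At `z = 1` a factor with `t` counted nontrivial elements contributes `t / (1 + t)`: at least
`1/2`, and at least `2/3` unless its order is `2`. The total exceeds `1` with three factors, or with
two of which one has order other than `2`. -/
theorem exists_one_lt_truncRatioSum_one (hfinite : ∀ i, (S i).Finite)
    (hsymm : ∀ i, ∀ s ∈ S i, s⁻¹ ∈ S i) (hgen : ∀ i, Subgroup.closure (S i) = ⊤)
    (hnontrivial : ∀ i, Nontrivial (G i)) (hcard : 2 ≤ Fintype.card ι)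
    (hexclude : ¬ (Fintype.card ι = 2 ∧ ∀ i, Nat.card (G i) = 2)) :
    ∃ n, 1 < truncRatioSum (fun i m => (sphereCount S i (m + 1) : ℝ)) n 1 := by
  classical
  have hset : ∀ i, ∃ T : Finset (G i), 1 ∉ T ∧ 1 ≤ T.card ∧ (Nat.card (G i) ≠ 2 → 2 ≤ T.card) := by
    intro i
    obtain ⟨g, hg⟩ := exists_ne (1 : G i)
    by_cases h : ∃ g' : G i, g' ≠ 1 ∧ g' ≠ g
    · obtain ⟨g', h1, h2⟩ := h
      have hc : ({g', g} : Finset (G i)).card = 2 := Finset.card_pair h2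
      exact ⟨{g', g}, by simp [h1.symm, hg.symm], by omega, fun _ => by omega⟩
    · push Not at h
      refine ⟨{g}, by simpa using hg.symm, by simp, fun h2 => absurd ?_ h2⟩
      refine Nat.card_eq_two_iff.2 ⟨1, g, hg.symm, Set.eq_univ_of_forall fun x => ?_⟩
      by_cases hx : x = 1
      · exact Or.inl hx
      · exact Or.inr (h x hx)
  choose T hT1 hT hT2 using hset
  set n := Finset.univ.sup fun i => (T i).sup fun g => freeProductLength S (CoprodI.of g)
  refine ⟨n, ?_⟩
  have hE : ∀ i, ((T i).card : ℝ) / (1 + (T i).card) ≤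
      (∑ m ∈ Finset.range n, (sphereCount S i (m + 1) : ℝ) * 1 ^ (m + 1)) /
        (1 + ∑ m ∈ Finset.range n, (sphereCount S i (m + 1) : ℝ) * 1 ^ (m + 1)) := fun i =>
    div_one_add_le_div_one_add (by positivity)
      (card_le_sum_sphereCount hfinite hsymm hgen i (hT1 i) fun g hg =>
        (Finset.le_sup (f := fun g => freeProductLength S (CoprodI.of g)) hg).trans
          (Finset.le_sup (f := fun i => (T i).sup fun g => freeProductLength S (CoprodI.of g))
            (Finset.mem_univ i)))
  refine lt_of_lt_of_le ?_ (Finset.sum_le_sum fun i _ => hE i)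
  have hhalf : ∀ i, (1 / 2 : ℝ) ≤ ((T i).card : ℝ) / (1 + (T i).card) := fun i => by
    have : (1 : ℝ) ≤ (T i).card := by exact_mod_cast hT i
    rw [div_le_div_iff₀ (by norm_num) (by positivity)]
    linarith
  have hsum : ∑ _ : ι, (1 / 2 : ℝ) = Fintype.card ι / 2 := by
    simp [div_eq_mul_inv]
  by_cases h : ∀ i, Nat.card (G i) = 2
  · have h3 : 3 ≤ Fintype.card ι := by
      by_contra hlt
      exact hexclude ⟨by omega, h⟩
    have h3' : (3 : ℝ) ≤ Fintype.card ι := by exact_mod_cast h3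
    refine lt_of_lt_of_le ?_ (Finset.sum_le_sum fun i _ => hhalf i)
    rw [hsum]
    linarith
  · push Not at h
    obtain ⟨i, hi⟩ := h
    have h2 : (2 : ℝ) ≤ Fintype.card ι := by exact_mod_cast hcard
    have hlt : (1 / 2 : ℝ) < ((T i).card : ℝ) / (1 + (T i).card) := by
      have : (2 : ℝ) ≤ (T i).card := by exact_mod_cast hT2 i hi
      rw [div_lt_div_iff₀ (by norm_num) (by positivity)]
      linarith
    refine lt_of_le_of_lt ?_ (Finset.sum_lt_sum (fun i _ => hhalf i) ⟨i, Finset.mem_univ i, hlt⟩)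
    rw [hsum]
    linarith

/-- To the left of the root, the ends can be covered economically. -/
theorem exists_isBallCover_of_ratioSum_lt_one (hfinite : ∀ i, (S i).Finite)
    (hsymm : ∀ i, ∀ s ∈ S i, s⁻¹ ∈ S i) (hgen : ∀ i, Subgroup.closure (S i) = ⊤)
    {α : ℝ} (hα₀ : 0 < α) (hα₁ : α < 1) {δ : ℝ} (hδ : 0 < δ)
    (hs : ∀ i, Summable fun m => (sphereCount S i (m + 1) : ℝ) * (α ^ δ) ^ (m + 1))
    (hlt : ratioSum (fun i m => (sphereCount S i (m + 1) : ℝ)) (α ^ δ) < 1)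
    (A : Set (FreeProductEnds S)) :
    ∃ K : ℝ, 0 < K ∧ ∀ ε : ℝ, 0 < ε → ε < 1 → ∃ C : Set (FreeProductEnds S × ℝ),
      IsBallCover (endDist α) A C ∧ (∀ p ∈ C, p.2 ≤ ε) ∧
      (C.encard : ℝ≥0∞) ≤ ENNReal.ofReal (K * ε ^ (-δ)) := by
  have hz : 0 < α ^ δ := Real.rpow_pos_of_pos hα₀ _
  obtain ⟨K, hK, hsphere⟩ := exists_encard_sphere_le hfinite hsymm hgen hz hs hlt
  -- The extra factor pays for rounding `ε` down to the power `α ^ (m + 1)`.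
  refine ⟨K * (α ^ δ)⁻¹, by positivity, fun ε hε hε1 => ?_⟩
  obtain ⟨m, hm1, hm2⟩ := exists_nat_pow_near_of_lt_one hε hε1.le hα₀ hα₁
  obtain ⟨C, hC, hrad, hcard⟩ := exists_isBallCover_endDist hα₀ hα₁
    (freeProductGraph_connected hgen) (ballBelow_freeProductGraph_finite hfinite hsymm hgen) A (m + 1)
  refine ⟨C, hC, fun p hp => (hrad p hp).trans_le hm1.le, ?_⟩
  refine (ENat.toENNReal_mono hcard).trans ((hsphere (m + 1)).trans (ENNReal.ofReal_le_ofReal ?_))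
  rw [mul_assoc]
  refine mul_le_mul_of_nonneg_left ?_ hK.le
  rw [pow_succ, mul_inv, mul_comm, Real.rpow_neg hε.le]
  refine mul_le_mul_of_nonneg_left ?_ (by positivity)
  rw [inv_le_inv₀ (by positivity) (Real.rpow_pos_of_pos hε _)]
  calc ε ^ δ ≤ (α ^ m) ^ δ := Real.rpow_le_rpow hε.le hm2 hδ.le
    _ = (α ^ δ) ^ m := by
      rw [← Real.rpow_natCast, ← Real.rpow_natCast, ← Real.rpow_mul hα₀.le,
        ← Real.rpow_mul hα₀.le, mul_comm]

/-- All sets of ends containing the ends of infinite words have the same dimensions. -/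
theorem dimensions_of_infiniteWordEnds_subset (hfinite : ∀ i, (S i).Finite)
    (hsymm : ∀ i, ∀ s ∈ S i, s⁻¹ ∈ S i) (hgen : ∀ i, Subgroup.closure (S i) = ⊤)
    {α : ℝ} (hα₀ : 0 < α) (hα₁ : α < 1) {z : ℝ} (hz0 : 0 < z) (hz1 : z < 1)
    (hs : ∀ i, Summable fun m => (sphereCount S i (m + 1) : ℝ) * z ^ (m + 1))
    (hleft : ∀ y, 0 < y → y < z →
      ratioSum (fun i m => (sphereCount S i (m + 1) : ℝ)) y < 1)
    (hright : ∀ y, z < y → y < 1 →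
      ∃ n, 1 < truncRatioSum (fun i m => (sphereCount S i (m + 1) : ℝ)) n y)
    {A : Set (FreeProductEnds S)} (hA : infiniteWordEnds S ⊆ A) :
    HasBoxDim (endDist α) A ((Real.log z / Real.log α : ℝ) : EReal) ∧
      hausdorffDim (endDist α) A = ((Real.log z / Real.log α : ℝ) : EReal) := by
  set D := Real.log z / Real.log α with hD
  have hlogα : Real.log α < 0 := Real.log_neg hα₀ hα₁
  have hD0 : 0 < D := div_pos_of_neg_of_neg (Real.log_neg hz0 hz1) hlogα
  -- As `δ ↦ α ^ δ` is strictly decreasing, exponents above `D` correspond to arguments left of the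
  -- root, and those below `D` to arguments right of it.
  have hzD : α ^ D = z := by
    rw [Real.rpow_def_of_pos hα₀, hD, mul_div_cancel₀ _ hlogα.ne, Real.exp_log hz0]
  have hupper : ∀ δ : ℝ, D < δ → upperBoxDim (endDist α) A ≤ δ ∧ hausdorffDim (endDist α) A ≤ δ := by
    intro δ hδ
    have hδ0 : 0 < δ := hD0.trans hδ
    have hlt : α ^ δ < z := hzD ▸ Real.rpow_lt_rpow_of_exponent_gt hα₀ hα₁ hδ
    have hpos : 0 < α ^ δ := Real.rpow_pos_of_pos hα₀ _
    obtain ⟨K, hK, hcov⟩ := exists_isBallCover_of_ratioSum_lt_one hfinite hsymm hgen hα₀ hα₁ hδ0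
      (fun i => summable_pow_of_le (fun m => Nat.cast_nonneg _) hpos.le hlt.le (hs i))
      (hleft _ hpos hlt) A
    exact ⟨upperBoxDim_le_of_cover hK hcov, hausdorffDim_le_of_cover hδ0.le hcov⟩
  have hlower : ∀ δ : ℝ, 0 < δ → δ < D →
      (δ : EReal) ≤ lowerBoxDim (endDist α) A ∧ (δ : EReal) ≤ hausdorffDim (endDist α) A := by
    intro δ hδ0 hδ
    have hlt : z < α ^ δ := hzD ▸ Real.rpow_lt_rpow_of_exponent_gt hα₀ hα₁ hδ
    obtain ⟨n, hn⟩ := hright _ hlt (Real.rpow_lt_one hα₀.le hα₁ hδ0)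
    have hpos : 0 < (α ^ δ) ^ n := pow_pos (Real.rpow_pos_of_pos hα₀ _) _
    have h := fun (C : Set (FreeProductEnds S × ℝ)) (hC : IsBallCover (endDist α) A C) hC1 =>
      le_tsum_of_isBallCover hfinite hsymm hgen hα₀ hα₁ hδ0 hn.le hA hC hC1
    exact ⟨le_lowerBoxDim_of_le_sum hpos hδ0.le h, le_hausdorffDim_of_le_sum hpos h⟩
  have hle : ∀ x : EReal, (∀ δ : ℝ, D < δ → x ≤ δ) → x ≤ D := fun x hx =>
    EReal.le_of_forall_lt_iff_le.1 fun δ hδ => hx δ (by exact_mod_cast hδ)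
  have hge : ∀ x : EReal, (∀ δ : ℝ, 0 < δ → δ < D → (δ : EReal) ≤ x) → (D : EReal) ≤ x := by
    intro x hx
    by_contra! hlt
    obtain ⟨y, hxy, hyD⟩ := EReal.lt_iff_exists_real_btwn.1 hlt
    have hyD' : y < D := by exact_mod_cast hyD
    -- The bound is available only for positive exponents; `D / 2` provides one in case `y ≤ 0`.
    have h1 := hx (max y (D / 2)) (lt_max_of_lt_right (by linarith))
      (max_lt hyD' (by linarith))
    have h2 : (y : EReal) ≤ ((max y (D / 2) : ℝ) : EReal) := by exact_mod_cast le_max_left _ _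
    exact (hxy.trans_le (h2.trans h1)).false
  have hboxUpper := hle _ fun δ hδ => (hupper δ hδ).1
  have hboxLower := hge _ fun δ h0 hδ => (hlower δ h0 hδ).1
  exact ⟨⟨le_antisymm (lowerBoxDim_le_upperBoxDim.trans hboxUpper) hboxLower,
      le_antisymm hboxUpper (hboxLower.trans lowerBoxDim_le_upperBoxDim)⟩,
    le_antisymm (hle _ fun δ hδ => (hupper δ hδ).2) (hge _ fun δ h0 hδ => (hlower δ h0 hδ).2)⟩

end Dimensions

theorem theorem3p5 {ι : Type*} [Fintype ι] {G : ι → Type*} [∀ i, Group (G i)]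
    (S : ∀ i, Set (G i))
    (hfinite : ∀ i, (S i).Finite)
    (hsymm : ∀ i, ∀ s ∈ S i, s⁻¹ ∈ S i)
    (hgen : ∀ i, Subgroup.closure (S i) = ⊤)
    (hnontrivial : ∀ i, Nontrivial (G i))
    (hcard : 2 ≤ Fintype.card ι)
    (hexclude : ¬ (Fintype.card ι = 2 ∧ ∀ i, Nat.card (G i) = 2))
    (α : ℝ) (hα₀ : 0 < α) (hα₁ : α < 1) :
    ∃ z : ℝ, IsLeast (sphereRoots S) z ∧
      HasBoxDim (endDist α) (Set.univ : Set (FreeProductEnds S))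
        ((Real.log z / Real.log α : ℝ) : EReal) ∧
      HasBoxDim (endDist α) (infiniteWordEnds S) ((Real.log z / Real.log α : ℝ) : EReal) ∧
      hausdorffDim (endDist α) (Set.univ : Set (FreeProductEnds S)) =
        ((Real.log z / Real.log α : ℝ) : EReal) ∧
      hausdorffDim (endDist α) (infiniteWordEnds S) =
        ((Real.log z / Real.log α : ℝ) : EReal) := by
  have : Nontrivial ι := Fintype.one_lt_card_iff_nontrivial.1 hcard
  obtain ⟨z, hz0, hz1, hs, hroot, hleft, hright⟩ := exists_root_ratioSum
    (a := fun i m => (sphereCount S i (m + 1) : ℝ)) (fun i m => Nat.cast_nonneg _)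
    (fun i => exists_sphereCount_pos hfinite hsymm hgen i)
    (fun i z hz hs => exists_gt_summable_of_submultiplicative
      (c := fun m => (sphereCount S i m : ℝ)) (fun m => Nat.cast_nonneg _)
      (fun m n => by exact_mod_cast sphereCount_add_le hfinite hsymm hgen i m n) hz hs)
    (exists_one_lt_truncRatioSum_one hfinite hsymm hgen hnontrivial hcard hexclude)
  have hdim := fun (A : Set (FreeProductEnds S)) (hA : infiniteWordEnds S ⊆ A) =>
    dimensions_of_infiniteWordEnds_subset hfinite hsymm hgen hα₀ hα₁ hz0 hz1 hs hleft hright hA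
  refine ⟨z, ⟨⟨hz0, hs, hroot⟩, fun y hy => ?_⟩, (hdim _ (Set.subset_univ _)).1,
    (hdim _ subset_rfl).1, (hdim _ (Set.subset_univ _)).2, (hdim _ subset_rfl).2⟩
  by_contra! hlt
  exact (hleft y hy.1 hlt).ne hy.2.2
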